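/- Let $E$ be a Hilbert $C^*$-module over a $C^*$-algebra $A$ and let $\mathcal L(E)$ be the $C^*$-algebra of adjointable operators on $E$. A *regular operator* in $E$ is a densely defined closed $A$-linear operator $T$ whose adjoint $T^*$ is densely defined and for which $1+T^*T$ has dense range; $\mathcal R(E)$ is the set of regular operators. $T\in\mathcal R(E)$ is *normal* if $D(T)=D(T^*)$ and $\langle Tv,Tv\rangle=\langle T^*v,T^*v\rangle$ for all $v\in D(T)$; it is *invertible* if it is injective and $T^{-1}$ (with domain the range of $T$) is regular. The *spectrum* $\sigma(T)$ is the set of $c\in\mathbb C$ for which there is no $S\in\mathcal L(E)$ with $S(T-c1)\subseteq (T-c1)S=1$. The *$z$-transform* of $T\in\mathcal R(E)$ is the unique $z_T\in\mathcal L(E)$ with $\|z_T\|\le 1$, $D(T)=(1-z_T^*z_T)^{1/2}E$ and $T(1-z_T^*z_T)^{1/2}v=z_Tv$ for all $v\in E$. If $X$ is a locally compact Hausdorff space and $\pi:C_0(X)\to\mathcal L(E)$ is a non-degenerate $*$-homomorphism (that is, $\pi(C_0(X))E$ has dense linear span), extended canonically to $C_b(X)$, then for $f\in C(X)$ the operator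 $\pi(f)\in\mathcal R(E)$ is the one with $z_{\pi(f)}=\pi\bigl(f(1+|f|^2)^{-1/2}\bigr)$. For $G\subseteq\mathbb C$, $\iota_G$ is the identity function on $G$ and $f_G$ is the restriction of $f$ to $G$. Let $T\in\mathcal R(E)$ be normal. 1. There is a unique non-degenerate $*$-homomorphism $\psi_T:C_0(\sigma(T))\to\mathcal L(E)$ with $\psi_T(\iota_{\sigma(T)})=T$, and it is injective. For $f\in C(\sigma(T))$ write $f(T)=\psi_T(f)$ (the usual functional calculus). 2. Let $K\subset\mathbb C$ be finite and such that $T-\lambda 1$ is invertible for every $\lambda\in K$. Then there is a unique non-degenerate $*$-homomorphism $\pi_K:C_0(\sigma(T)\setminus K)\to\mathcal L(E)$ with $\pi_K(\iota_{\sigma(T)\setminus K})=T$. Moreover $f(T)=\pi_K(f_{\sigma(T)\setminus K})$ for every $f\in C(\sigma(T))$. 3. Call a continuous function $f:D\to\mathbb C$, $D\subseteq\mathbb C$, *compatible* with $T$ if $\sigma(T)\setminus K\subseteq D$ for some $K$ as in 2. For such $f$ the operator $f(T)=\pi_K(f_{\sigma(T)\setminus K})$ is a normal regular operator that does not depend on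 the choice of $K$ as in 2 with $\sigma(T)\setminus K\subseteq D$. 4. Call $G\subseteq\mathbb C$ *compatible* with $T$ if $G\cup L$ is closed for some finite $L\subset\mathbb C$ and $\sigma(T)\setminus K\subseteq G$ for some $K$ as in 2. For such $G$ there is a unique non-degenerate $*$-homomorphism $\pi:C_0(G)\to\mathcal L(E)$ with $\pi(\iota_G)=T$; it satisfies $\pi(g)=g(T)$ for every $g\in C_0(G)$ (in particular $g(T)\in\mathcal L(E)$) and, more generally, $\pi(f)=f(T)$ for every $f\in C(G)$, where $g(T)$ and $f(T)$ are the operators of 3. -/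

import Mathlib

open scoped ZeroAtInfty

noncomputable section

namespace HilbertModule

/-! Throughout, `E` is a Hilbert C⋆-module over the (possibly non-unital) C⋆-algebra `A`, that is,
a complete `CStarModule A E`. Mathlib writes the `A`-action on the left and lets the inner product
be linear in the second variable; a right Hilbert module over `B` is the case `A = Bᵐᵒᵖ`. -/

section Adjointable

variable (A E : Type*) [NonUnitalCStarAlgebra A] [PartialOrder A] [StarOrderedRing A]
  [NormedAddCommGroup E] [NormedSpace ℂ E] [SMul A E] [CStarModule A E]

/-- The adjointable operators on `E`, as a subalgebra of the bounded operators. -/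
def adjointables : Subalgebra ℂ (E →L[ℂ] E) where
  carrier := {T | ∃ S : E →L[ℂ] E, ∀ x y, inner A (T x) y = inner A x (S y)}
  mul_mem' := by
    rintro T T' ⟨S, hS⟩ ⟨S', hS'⟩
    exact ⟨S' * S, fun x y => by
      rw [mul_apply_eq_comp, hS, hS', mul_apply_eq_comp]⟩
  add_mem' := by
    rintro T T' ⟨S, hS⟩ ⟨S', hS'⟩
    exact ⟨S + S', fun x y => by
      simp only [add_apply, CStarModule.inner_add_left,
        CStarModule.inner_add_right, hS, hS']⟩
  algebraMap_mem' := by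
    intro c
    refine ⟨algebraMap ℂ (E →L[ℂ] E) (star c), fun x y => ?_⟩
    simp [Algebra.algebraMap_eq_smul_one]

/-- The algebra `𝓛(E)` of adjointable operators on `E`, with the operator norm. -/
def Adjointable : Type _ := adjointables A E

instance : NormedRing (Adjointable A E) := inferInstanceAs (NormedRing (adjointables A E))

instance : NormedAlgebra ℂ (Adjointable A E) :=
  inferInstanceAs (NormedAlgebra ℂ (adjointables A E))

variable {A E}

theorem eq_of_forall_inner {v w : E} (h : ∀ x : E, inner A x v = inner A x w) : v = w := by
  have h1 : inner A (v - w) (v - w) = (0 : A) := by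
    rw [CStarModule.inner_sub_right, h, sub_self]
  exact sub_eq_zero.mp (CStarModule.inner_self.mp h1)

/-- The adjoint of an adjointable operator. -/
instance : Star (Adjointable A E) where
  star T := ⟨T.2.choose, T.1, fun x y => by
    have h := T.2.choose_spec y x
    have h' := congrArg star h
    rw [CStarModule.star_inner, CStarModule.star_inner] at h'
    exact h'.symm⟩

theorem val_mul (S T : Adjointable A E) (x : E) : (S * T).1 x = S.1 (T.1 x) := rfl

theorem val_add (S T : Adjointable A E) (x : E) : (S + T).1 x = S.1 x + T.1 x := rfl

theorem val_smul (c : ℂ) (T : Adjointable A E) (x : E) : (c • T).1 x = c • T.1 x := rfl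

theorem norm_val (T : Adjointable A E) : ‖T.1‖ = ‖T‖ := rfl

theorem isometry_val : Isometry fun T : Adjointable A E => T.1 :=
  Isometry.of_dist_eq fun _ _ => rfl

theorem inner_apply_left (T : Adjointable A E) (x y : E) :
    inner A (T.1 x) y = inner A x ((star T).1 y) := T.2.choose_spec x y

theorem inner_apply_right (T : Adjointable A E) (x y : E) :
    inner A x (T.1 y) = inner A ((star T).1 x) y := by
  have h' := congrArg star (inner_apply_left T y x)
  rw [CStarModule.star_inner, CStarModule.star_inner] at h'
  exact h'

theorem adjointable_ext {S T : Adjointable A E}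
    (h : ∀ x y : E, inner A x (S.1 y) = inner A x (T.1 y)) : S = T :=
  Subtype.ext (ContinuousLinearMap.ext fun y => eq_of_forall_inner fun x => h x y)

instance : StarRing (Adjointable A E) where
  star_involutive T := adjointable_ext fun x y => by
    rw [← inner_apply_left, ← inner_apply_right]
  star_mul S T := adjointable_ext fun x y => by
    rw [← inner_apply_left]
    simp only [val_mul]
    rw [inner_apply_left, inner_apply_left]
  star_add S T := adjointable_ext fun x y => by
    rw [← inner_apply_left]
    simp only [val_add, CStarModule.inner_add_left,
      CStarModule.inner_add_right, inner_apply_left]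

instance : StarModule ℂ (Adjointable A E) where
  star_smul c T := adjointable_ext fun x y => by
    rw [← inner_apply_left]
    simp only [val_smul,
      CStarModule.inner_smul_left_complex, CStarModule.inner_smul_right_complex, inner_apply_left]

instance : CStarRing (Adjointable A E) where
  norm_mul_self_le T := by
    have key : ‖T.1‖ ≤ √‖star T * T‖ := by
      refine ContinuousLinearMap.opNorm_le_bound _ (Real.sqrt_nonneg _) fun x => ?_
      have h1 : ‖T.1 x‖ ^ 2 ≤ ‖star T * T‖ * ‖x‖ ^ 2 := by
        calc ‖T.1 x‖ ^ 2 = ‖inner A (T.1 x) (T.1 x)‖ := CStarModule.norm_sq_eq A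
          _ = ‖inner A x ((star T * T).1 x)‖ := by rw [inner_apply_left]; rfl
          _ ≤ ‖x‖ * ‖(star T * T).1 x‖ := CStarModule.norm_inner_le E
          _ ≤ ‖x‖ * (‖star T * T‖ * ‖x‖) := by
              gcongr
              exact (star T * T).1.le_opNorm x
          _ = _ := by ring
      calc ‖T.1 x‖ = √(‖T.1 x‖ ^ 2) := (Real.sqrt_sq (norm_nonneg _)).symm
        _ ≤ √(‖star T * T‖ * ‖x‖ ^ 2) := Real.sqrt_le_sqrt h1
        _ = √‖star T * T‖ * ‖x‖ := by
            rw [Real.sqrt_mul (norm_nonneg (star T * T)), Real.sqrt_sq (norm_nonneg x)]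
    calc ‖T‖ * ‖T‖ ≤ √‖star T * T‖ * √‖star T * T‖ := by
          gcongr <;> exact key
      _ = ‖star T * T‖ := Real.mul_self_sqrt (norm_nonneg _)

instance [CompleteSpace E] : CompleteSpace (Adjointable A E) := by
  refine Metric.complete_of_cauchySeq_tendsto fun u hu => ?_
  have hiso : Isometry (fun T : Adjointable A E => star T) := Isometry.of_dist_eq fun S T => by
    rw [dist_eq_norm, dist_eq_norm, ← star_sub, norm_star]
  have hu1 : CauchySeq fun n => (u n).1 := hu.map isometry_val.uniformContinuous
  have hu2 : CauchySeq fun n => (star (u n)).1 :=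
    (hu.map hiso.uniformContinuous).map isometry_val.uniformContinuous
  obtain ⟨T, hT⟩ := cauchySeq_tendsto_of_complete hu1
  obtain ⟨S, hS⟩ := cauchySeq_tendsto_of_complete hu2
  have hTS : ∀ x y, inner A (T x) y = inner A x (S y) := by
    intro x y
    have h1 : Filter.Tendsto (fun n => inner A ((u n).1 x) y) Filter.atTop
        (nhds (inner A (T x) y)) := by
      have hx : Filter.Tendsto (fun n => (u n).1 x) Filter.atTop (nhds (T x)) :=
        ((ContinuousLinearMap.apply ℂ E x).continuous.tendsto T).comp hT
      exact (CStarModule.continuous_inner.tendsto (T x, y)).comp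
        (hx.prodMk_nhds tendsto_const_nhds)
    have h2 : Filter.Tendsto (fun n => inner A x ((star (u n)).1 y)) Filter.atTop
        (nhds (inner A x (S y))) := by
      have hy : Filter.Tendsto (fun n => (star (u n)).1 y) Filter.atTop (nhds (S y)) :=
        ((ContinuousLinearMap.apply ℂ E y).continuous.tendsto S).comp hS
      exact (CStarModule.continuous_inner.tendsto (x, S y)).comp
        (tendsto_const_nhds.prodMk_nhds hy)
    simp only [inner_apply_left] at h1
    exact tendsto_nhds_unique h1 h2
  exact ⟨⟨T, S, hTS⟩, isometry_val.isEmbedding.tendsto_nhds_iff.mpr hT⟩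

/-- `𝓛(E)` is a unital C⋆-algebra. -/
instance [CompleteSpace E] : CStarAlgebra (Adjointable A E) where

end Adjointable

section Regular

variable (A : Type*) {E : Type*} [NonUnitalCStarAlgebra A] [PartialOrder A] [StarOrderedRing A]
  [NormedAddCommGroup E] [NormedSpace ℂ E] [SMul A E] [CStarModule A E]

/-- The set of pairs `(v, w)` with `⟨T u, v⟩ = ⟨u, w⟩` for all `u ∈ D(T)`. -/
def adjointGraph (T : E →ₗ.[ℂ] E) : Submodule ℂ (E × E) where
  carrier := {p | ∀ u : T.domain, inner A (T u) p.1 = inner A (u : E) p.2}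
  add_mem' := by
    intro p q hp hq u
    simp only [Prod.fst_add, Prod.snd_add, CStarModule.inner_add_right, hp u, hq u]
  zero_mem' := by
    intro u
    simp
  smul_mem' := by
    intro c p hp u
    simp only [Prod.smul_fst, Prod.smul_snd, CStarModule.inner_smul_right_complex, hp u]

/-- The adjoint `T⋆` of a densely defined operator. -/
def adjoint (T : E →ₗ.[ℂ] E) : E →ₗ.[ℂ] E := (adjointGraph A T).toLinearPMap

/-- Regular operators in `E`: densely defined closed `A`-linear operators whose adjoint is densely
defined and for which `1 + T⋆T` has dense range. -/
structure IsRegular (T : E →ₗ.[ℂ] E) : Prop where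
  dense_domain : Dense (T.domain : Set E)
  smul_mem : ∀ (a : A) (x : E), x ∈ T.domain → a • x ∈ T.domain
  map_smul : ∀ (a : A) (x : E) (hx : x ∈ T.domain),
    T ⟨a • x, smul_mem a x hx⟩ = a • T ⟨x, hx⟩
  isClosed : T.IsClosed
  dense_domain_adjoint : Dense ((adjoint A T).domain : Set E)
  dense_range : Dense {y : E | ∃ (x : T.domain) (h : T x ∈ (adjoint A T).domain),
    y = (x : E) + adjoint A T ⟨T x, h⟩}

/-- Normality: `D(T) = D(T⋆)` and `⟨T v, T v⟩ = ⟨T⋆ v, T⋆ v⟩` for all `v ∈ D(T)`. -/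
def IsNormal (T : E →ₗ.[ℂ] E) : Prop :=
  ∃ h : T.domain = (adjoint A T).domain, ∀ v : T.domain,
    inner A (T v) (T v) =
      inner A (adjoint A T ⟨v, h ▸ v.2⟩) (adjoint A T ⟨v, h ▸ v.2⟩)

/-- Invertibility in the sense of regular operators: `T` is injective and `T⁻¹`, with domain the
range of `T`, is regular. -/
def IsInvertible (T : E →ₗ.[ℂ] E) : Prop :=
  (∀ x y : T.domain, T x = T y → x = y) ∧ IsRegular A T.inverse

/-- The operator `T - c 1` with domain `D(T)`. -/
def subScalar (T : E →ₗ.[ℂ] E) (c : ℂ) : E →ₗ.[ℂ] E where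
  domain := T.domain
  toFun := T.toFun - c • T.domain.subtype

/-- Adjointable invertibility: there is `S ∈ 𝓛(E)` with `S T ⊆ T S = 1`. -/
def IsAdjointableInvertible (T : E →ₗ.[ℂ] E) : Prop :=
  ∃ S : Adjointable A E, (∀ x : T.domain, S.1 (T x) = x) ∧
    ∀ y : E, ∃ h : S.1 y ∈ T.domain, T ⟨S.1 y, h⟩ = y

/-- The spectrum `σ(T)`. -/
def opSpectrum (T : E →ₗ.[ℂ] E) : Set ℂ :=
  {c | ¬ IsAdjointableInvertible A (subScalar T c)}

end Regular

section Calculus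

variable {A E : Type*} [NonUnitalCStarAlgebra A] [PartialOrder A] [StarOrderedRing A]
  [NormedAddCommGroup E] [NormedSpace ℂ E] [SMul A E] [CStarModule A E] [CompleteSpace E]

/-- The operator with `z`-transform `z`: its domain is `(1 - z⋆z)^{1/2} E`, and it sends
`(1 - z⋆z)^{1/2} v` to `z v`. -/
def ofZTransform (z : Adjointable A E) : E →ₗ.[ℂ] E :=
  (LinearMap.range
    (((cfc Real.sqrt (1 - star z * z)).1 : E →ₗ[ℂ] E).prod (z.1 : E →ₗ[ℂ] E))).toLinearPMap

variable {X : Type*} [TopologicalSpace X]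

/-- The product of a bounded continuous function and a function vanishing at infinity. -/
def bcfMul (m : BoundedContinuousFunction X ℂ) (g : C₀(X, ℂ)) : C₀(X, ℂ) where
  toFun x := m x * g x
  continuous_toFun := m.continuous.mul g.continuous
  zero_at_infty' := by
    refine squeeze_zero_norm (a := fun x => ‖m‖ * ‖g x‖) (fun x => ?_) ?_
    · rw [norm_mul]
      exact mul_le_mul_of_nonneg_right (m.norm_coe_le_norm x) (norm_nonneg _)
    · simpa using (g.zero_at_infty'.norm).const_mul ‖m‖

/-- A continuous function `f` on `X`, regarded as an element affiliated with `C₀(X)` (acting by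
multiplication on `{g | f g ∈ C₀(X)}`), has `z`-transform `f (1 + |f|²)^{-1/2}` in
`M(C₀(X)) = C_b(X)`. -/
def zFun (f : C(X, ℂ)) : BoundedContinuousFunction X ℂ :=
  BoundedContinuousFunction.ofNormedAddCommGroup
    (fun x => f x / ((√(1 + ‖f x‖ ^ 2) : ℝ) : ℂ))
    (by
      refine f.continuous.div (by fun_prop) fun x => ?_
      have : 0 < √(1 + ‖f x‖ ^ 2) := Real.sqrt_pos.mpr (by positivity)
      exact_mod_cast this.ne')
    1
    (fun x => by
      have h0 : 0 < √(1 + ‖f x‖ ^ 2) := Real.sqrt_pos.mpr (by positivity)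
      rw [norm_div, Complex.norm_real, Real.norm_of_nonneg h0.le, div_le_one h0]
      exact Real.le_sqrt_of_sq_le (by linarith))

/-- A ⋆-homomorphism `π : C₀(X) → 𝓛(E)` is non-degenerate if `π(C₀(X)) E` has dense span. -/
def IsNondegenerate (π : C₀(X, ℂ) →⋆ₙₐ[ℂ] Adjointable A E) : Prop :=
  Dense (Submodule.span ℂ {w : E | ∃ (g : C₀(X, ℂ)) (v : E), w = (π g).1 v} : Set E)

open Classical in
/-- The extension of a non-degenerate `π` to `M(C₀(X)) = C_b(X)`: the operator `y ∈ 𝓛(E)`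
determined by `y π(g) v = π(m g) v`. -/
def multiplierExt (π : C₀(X, ℂ) →⋆ₙₐ[ℂ] Adjointable A E) (m : BoundedContinuousFunction X ℂ) :
    Adjointable A E :=
  if h : ∃ y : Adjointable A E, ∀ (g : C₀(X, ℂ)) (v : E), y.1 ((π g).1 v) = (π (bcfMul m g)).1 v
  then h.choose else 0

/-- The image `π(f)` of a continuous function `f` on `X` under a non-degenerate `π`: the regular
operator whose `z`-transform is the image under `π` of the `z`-transform of `f`. -/
def affiliatedImage (π : C₀(X, ℂ) →⋆ₙₐ[ℂ] Adjointable A E) (f : C(X, ℂ)) : E →ₗ.[ℂ] E :=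
  ofZTransform (multiplierExt π (zFun f))

/-- The identity function `ι_G` on a subset `G` of the plane. -/
def idFun (G : Set ℂ) : C(G, ℂ) := ⟨Subtype.val, continuous_subtype_val⟩

/-- The restriction of a continuous function on `H` to a subset `G ⊆ H`. -/
def restrictTo {G H : Set ℂ} (h : G ⊆ H) (f : C(H, ℂ)) : C(G, ℂ) :=
  f.comp ⟨Set.inclusion h, continuous_inclusion h⟩

/-- `π` is a non-degenerate ⋆-homomorphism `C₀(G) → 𝓛(E)` with `π(ι_G) = T`. -/
def IsCalculus {G : Set ℂ} (T : E →ₗ.[ℂ] E) (π : C₀(G, ℂ) →⋆ₙₐ[ℂ] Adjointable A E) : Prop :=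
  IsNondegenerate π ∧ affiliatedImage π (idFun G) = T

variable (A)

open Classical in
/-- The functional calculus `ψ_T : C₀(σ(T)) → 𝓛(E)` of a normal regular operator: the injective
non-degenerate ⋆-homomorphism with `ψ_T(ι) = T`. -/
def stdCalculus (T : E →ₗ.[ℂ] E) : C₀(opSpectrum A T, ℂ) →⋆ₙₐ[ℂ] Adjointable A E :=
  if h : ∃ ψ : C₀(opSpectrum A T, ℂ) →⋆ₙₐ[ℂ] Adjointable A E,
    IsCalculus T ψ ∧ Function.Injective ψ
  then h.choose else 0

/-- The usual functional calculus `f(T) = ψ_T(f)` for `f ∈ C(σ(T))`. -/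
def stdFun (T : E →ₗ.[ℂ] E) (f : C(opSpectrum A T, ℂ)) : E →ₗ.[ℂ] E :=
  affiliatedImage (stdCalculus A T) f

/-- `K` is a finite set of points `c` for which `T - c 1` is invertible, and `σ(T) \ K ⊆ D`. -/
def IsAdmissible (T : E →ₗ.[ℂ] E) (D : Set ℂ) (K : Finset ℂ) : Prop :=
  (∀ c ∈ K, IsInvertible A (subScalar T c)) ∧ opSpectrum A T \ K ⊆ D

/-- A continuous function with domain `D ⊆ ℂ` is compatible with `T` if it is defined on
`σ(T) \ K` for some finite set `K` of points `c` for which `T - c 1` is invertible. -/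
def IsCompatibleDomain (T : E →ₗ.[ℂ] E) (D : Set ℂ) : Prop :=
  ∃ K : Finset ℂ, IsAdmissible A T D K

/-- `G` is almost closed if `G ∪ K` is closed for some finite set `K`. -/
def IsAlmostClosed (G : Set ℂ) : Prop := ∃ K : Finset ℂ, IsClosed (G ∪ K)

/-- A set is compatible with `T` if it is almost closed and contains `σ(T) \ K` for some finite set
`K` of points `c` for which `T - c 1` is invertible. -/
def IsCompatibleSet (T : E →ₗ.[ℂ] E) (G : Set ℂ) : Prop :=
  IsAlmostClosed G ∧ ∃ K : Finset ℂ, IsAdmissible A T G K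

open Classical in
/-- The extended functional calculus `f(T)` for a continuous function `f` with domain `D` that is
compatible with `T`: take an admissible `K` and the ⋆-homomorphism `π` on `C₀(σ(T) \ K)` with
`π(ι) = T`, and put `f(T) = π(f)`, with `f` restricted to `σ(T) \ K`. -/
def extFun (T : E →ₗ.[ℂ] E) {D : Set ℂ} (f : C(D, ℂ)) : E →ₗ.[ℂ] E :=
  if h : ∃ (K : Finset ℂ) (_ : IsAdmissible A T D K)
      (π : C₀((opSpectrum A T \ K : Set ℂ), ℂ) →⋆ₙₐ[ℂ] Adjointable A E), IsCalculus T π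
  then affiliatedImage h.choose_spec.choose_spec.choose
    (restrictTo h.choose_spec.choose.2 f)
  else 0

end Calculus

end HilbertModule

end

/-! A normal regular operator `T` is recovered from its bounded transform `z`, a normal contraction
with `(1 - z⋆z)^{1/2}` of dense range, built from the resolvent `(1 + T⋆T)⁻¹`. The embedding
`t ↦ t (1 + |t|²)^{-1/2}` of the plane onto the open unit disc sends `σ(T)` to the part of the
spectrum of `z` inside the disc, so that a function `g ∈ C₀(G)`, transported to the disc and
extended by zero to the circle and to the finitely many points missing from `G`, is continuous on
the spectrum of `z` and can be applied to `z`. The resulting ⋆-homomorphism is non-degenerate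
because `(1 - z⋆z)^{1/2}` and every `T - λ 1` with `λ` a missing point have dense range. It is the
only one, because a non-degenerate `π` with `π(ι) = T` sends `ι (1 + |ι|²)^{-1/2}` to `z`, and every
`g ∈ C₀(G)` is a continuous function of `ι (1 + |ι|²)^{-1/2}`. -/

noncomputable section

open scoped BoundedContinuousFunction CStarAlgebra

namespace HilbertModule

section Adjointable

variable {A E : Type*} [NonUnitalCStarAlgebra A] [PartialOrder A]
  [NormedAddCommGroup E] [NormedSpace ℂ E] [SMul A E] [CStarModule A E]

theorem val_sub (S T : Adjointable A E) (x : E) : (S - T).1 x = S.1 x - T.1 x := rfl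

theorem val_one (x : E) : (1 : Adjointable A E).1 x = x := rfl

theorem Adjointable.ext {S T : Adjointable A E} (h : ∀ x, S.1 x = T.1 x) : S = T :=
  Subtype.ext (ContinuousLinearMap.ext h)

theorem Adjointable.ext_of_dense {S T : Adjointable A E} {s : Set E} (hs : Dense s)
    (h : ∀ x ∈ s, S.1 x = T.1 x) : S = T :=
  Subtype.ext (DFunLike.coe_injective (Continuous.ext_on hs S.1.continuous T.1.continuous h))

theorem denseRange_left_of_mul {S T : Adjointable A E} (h : DenseRange (S * T).1) :
    DenseRange S.1 :=
  Dense.mono (Set.range_comp_subset_range T.1 S.1) h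

theorem denseRange_mul {S T : Adjointable A E} (hS : DenseRange S.1) (hT : DenseRange T.1) :
    DenseRange (S * T).1 :=
  show DenseRange (S.1 ∘ T.1) from hS.comp hT S.1.continuous

theorem inner_eq_of_inner_self_eq {V : Type*} [AddCommGroup V] [Module ℂ V] {f g : V →ₗ[ℂ] E}
    (h : ∀ v, inner A (f v) (f v) = inner A (g v) (g v)) (v w : V) :
    inner A (f v) (f w) = inner A (g v) (g w) := by
  let d (v w : V) : A := inner A (f v) (f w) - inner A (g v) (g w)
  have hadd : d v w + d w v = 0 := by
    have hvw := h (v + w)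
    simp only [map_add, CStarModule.inner_add_left, CStarModule.inner_add_right, h] at hvw
    rw [← sub_eq_zero] at hvw
    rw [← hvw]
    simp only [d]
    abel
  have hsub : Complex.I • (d v w - d w v) = 0 := by
    have hvw := h (v + Complex.I • w)
    simp only [map_add, map_smul, CStarModule.inner_add_left, CStarModule.inner_add_right,
      CStarModule.inner_smul_left_complex, CStarModule.inner_smul_right_complex, h,
      Complex.star_def, Complex.conj_I] at hvw
    rw [← sub_eq_zero] at hvw
    rw [← hvw]
    simp only [d, smul_sub, smul_add, neg_smul, smul_neg]
    abel
  have hsymm : d v w = d w v :=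
    sub_eq_zero.mp ((smul_eq_zero.mp hsub).resolve_left Complex.I_ne_zero)
  rw [← hsymm, ← two_smul ℂ] at hadd
  exact sub_eq_zero.mp ((smul_eq_zero.mp hadd).resolve_left two_ne_zero)

variable [StarOrderedRing A]

theorem continuous_inner_left (y : E) : Continuous fun x : E => inner A x y :=
  CStarModule.continuous_inner.comp (continuous_id.prodMk continuous_const)

theorem continuous_inner_right (x : E) : Continuous fun y : E => inner A x y :=
  CStarModule.continuous_inner.comp (continuous_const.prodMk continuous_id)

theorem eq_of_dense_inner {s : Set E} (hs : Dense s) {v w : E}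
    (h : ∀ x ∈ s, inner A x v = inner A x w) : v = w :=
  eq_of_forall_inner (A := A) fun x =>
    congrFun (Continuous.ext_on hs (continuous_inner_left v) (continuous_inner_left w) h) x

theorem norm_le_of_inner_self_le {x y : E} (h : inner A x x ≤ inner A y y) : ‖x‖ ≤ ‖y‖ := by
  refine le_of_sq_le_sq ?_ (norm_nonneg _)
  rw [CStarModule.norm_sq_eq A, CStarModule.norm_sq_eq A]
  exact CStarAlgebra.norm_le_norm_of_nonneg_of_le CStarModule.inner_self_nonneg h

theorem norm_le_of_dense_norm_inner_le {s : Set E} (hs : Dense s) {y : E} {C : ℝ} (hC : 0 ≤ C)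
    (h : ∀ x ∈ s, ‖inner A x y‖ ≤ C * ‖x‖) : ‖y‖ ≤ C := by
  have hy : ‖inner A y y‖ ≤ C * ‖y‖ := by
    have hclosed : IsClosed {x : E | ‖inner A x y‖ ≤ C * ‖x‖} :=
      isClosed_le (continuous_inner_left y).norm (by fun_prop)
    exact hclosed.closure_subset_iff.mpr h (hs y)
  rw [← CStarModule.norm_sq_eq A] at hy
  rcases (norm_nonneg y).eq_or_lt with h0 | hpos
  · exact h0 ▸ hC
  · exact le_of_mul_le_mul_right (by rwa [← sq]) hpos

theorem map_smul_adjointable (S : Adjointable A E) (a : A) (x : E) :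
    S.1 (a • x) = a • S.1 x :=
  eq_of_forall_inner (A := A) fun y => by
    rw [inner_apply_right, CStarModule.inner_op_smul_right, CStarModule.inner_op_smul_right,
      inner_apply_right]

/-- Only `e v ↦ f v` has to be bounded: being adjoint to it, `e' w ↦ g w` then obeys the same
bound. -/
theorem exists_adjointable_extension [CompleteSpace E] {V W : Type*} [AddCommGroup V] [Module ℂ V]
    [AddCommGroup W] [Module ℂ W] {e f : V →ₗ[ℂ] E} {e' g : W →ₗ[ℂ] E} (he : DenseRange e)
    (he' : DenseRange e') {C : ℝ} (hC : 0 ≤ C) (hf : ∀ v, ‖f v‖ ≤ C * ‖e v‖)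
    (hfg : ∀ v w, inner A (f v) (e' w) = inner A (e v) (g w)) :
    ∃ S : Adjointable A E, (∀ v, S.1 (e v) = f v) ∧ ∀ w, (star S).1 (e' w) = g w := by
  have hg (w : W) : ‖g w‖ ≤ C * ‖e' w‖ := by
    refine norm_le_of_dense_norm_inner_le (A := A) he (by positivity) ?_
    rintro _ ⟨v, rfl⟩
    calc ‖inner A (e v) (g w)‖ = ‖inner A (f v) (e' w)‖ := by rw [hfg]
      _ ≤ ‖f v‖ * ‖e' w‖ := CStarModule.norm_inner_le E
      _ ≤ C * ‖e v‖ * ‖e' w‖ := by gcongr; exact hf v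
      _ = C * ‖e' w‖ * ‖e v‖ := by ring
  have hFe := LinearMap.extendOfNorm_eq he ⟨C, hf⟩
  have hGe' := LinearMap.extendOfNorm_eq he' ⟨C, hg⟩
  set F := f.extendOfNorm e
  set G := g.extendOfNorm e'
  have hFG : (fun p : E × E => inner A (F p.1) p.2) = fun p => inner A p.1 (G p.2) := by
    refine Continuous.ext_on (he.prodMap he')
      (CStarModule.continuous_inner.comp ((F.continuous.comp continuous_fst).prodMk continuous_snd))
      (CStarModule.continuous_inner.comp (continuous_fst.prodMk (G.continuous.comp continuous_snd)))
      ?_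
    rintro _ ⟨⟨v, w⟩, rfl⟩
    simp only [Prod.map_apply, hFe, hGe', hfg]
  let S : Adjointable A E := ⟨F, G, fun x y => congrFun hFG (x, y)⟩
  refine ⟨S, hFe, fun w => eq_of_forall_inner (A := A) fun x => ?_⟩
  rw [← inner_apply_left, ← hGe']
  exact congrFun hFG (x, e' w)

theorem eq_zero_of_dense_range {S : Adjointable A E} (hS : DenseRange S.1) {x : E}
    (hx : (star S).1 x = 0) : x = 0 := by
  refine eq_of_dense_inner (A := A) hS ?_
  rintro _ ⟨y, rfl⟩
  rw [inner_apply_left, hx, CStarModule.inner_zero_right, CStarModule.inner_zero_right]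

theorem denseRange_of_isUnit {S : Adjointable A E} (h : IsUnit S) : DenseRange S.1 := by
  obtain ⟨V, hV⟩ := h.exists_right_inv
  exact Function.Surjective.denseRange fun y => ⟨V.1 y, by rw [← val_mul, hV, val_one]⟩

variable [CompleteSpace E]

instance : PartialOrder (Adjointable A E) := CStarAlgebra.spectralOrder _

instance : StarOrderedRing (Adjointable A E) := CStarAlgebra.spectralOrderedRing _

end Adjointable

section BoundedFunction

variable {X : Type*} [TopologicalSpace X]

theorem bcf_cfc_apply (m : X →ᵇ ℂ) {h : ℂ → ℂ} (hh : ContinuousOn h (spectrum ℂ m)) (x : X) :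
    cfc h m x = h (m x) := by
  let eval : (X →ᵇ ℂ) →⋆ₐ[ℂ] ℂ :=
    (ContinuousMap.evalStarAlgHom ℂ ℂ x).comp (BoundedContinuousFunction.toContinuousMapStarₐ ℂ)
  have heval : Continuous eval := map_continuous eval
  calc eval (cfc h m) = cfc h (algebraMap ℂ ℂ (m x)) :=
        StarAlgHomClass.map_cfc eval h m hh heval inferInstance inferInstance
    _ = h (m x) := cfc_algebraMap _ _

theorem spectrum_bcf_subset (m : X →ᵇ ℂ) : spectrum ℂ m ⊆ closure (Set.range m) := by
  intro c hc
  by_contra hcm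
  obtain ⟨ε, hε, hball⟩ := Metric.isOpen_iff.mp isClosed_closure.isOpen_compl c hcm
  have hdist (x : X) : ε ≤ ‖c - m x‖ := by
    by_contra! hlt
    exact hball (Metric.mem_ball'.mpr (by rwa [dist_eq_norm])) (subset_closure ⟨x, rfl⟩)
  have hne (x : X) : c - m x ≠ 0 := norm_pos_iff.mp (hε.trans_le (hdist x))
  let inv : X →ᵇ ℂ := .ofNormedAddCommGroup (fun x => (c - m x)⁻¹)
    ((continuous_const.sub m.continuous).inv₀ hne) ε⁻¹ fun x => by
      rw [norm_inv]
      exact inv_anti₀ hε (hdist x)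
  exact hc (IsUnit.of_mul_eq_one inv (BoundedContinuousFunction.ext fun x =>
    mul_inv_cancel₀ (hne x)))

open scoped ComplexOrder in
theorem exists_star_mul_self_eq {m : X →ᵇ ℂ} (hm : ∀ x, 0 ≤ m x) :
    ∃ c : X →ᵇ ℂ, star c * c = m := by
  refine ⟨cfc (fun t => ((√t.re : ℝ) : ℂ)) m, BoundedContinuousFunction.ext fun x => ?_⟩
  rw [BoundedContinuousFunction.coe_mul, Pi.mul_apply, BoundedContinuousFunction.star_apply,
    bcf_cfc_apply m (by fun_prop), Complex.star_def, Complex.conj_ofReal, ← Complex.ofReal_mul,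
    Real.mul_self_sqrt (Complex.nonneg_iff.mp (hm x)).1]
  exact (Complex.eq_re_of_ofReal_le (hm x)).symm

theorem exists_star_mul_self_add_star_mul_self_eq (m : X →ᵇ ℂ) :
    ∃ c : X →ᵇ ℂ, star c * c + star m * m = ((‖m‖ ^ 2 : ℝ) : ℂ) • 1 := by
  let _ : PartialOrder (X →ᵇ ℂ) := CStarAlgebra.spectralOrder _
  let _ : StarOrderedRing (X →ᵇ ℂ) := CStarAlgebra.spectralOrderedRing _
  obtain ⟨c, hc⟩ := CStarAlgebra.nonneg_iff_eq_star_mul_self.mp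
    (sub_nonneg.mpr (CStarAlgebra.star_mul_le_algebraMap_norm_sq (a := m)))
  refine ⟨c, ?_⟩
  rw [← hc, sub_add_cancel, Algebra.algebraMap_eq_smul_one, ← Complex.coe_smul]

end BoundedFunction

section Multiplier

variable {A E : Type*} [NonUnitalCStarAlgebra A] [PartialOrder A] [StarOrderedRing A]
  [NormedAddCommGroup E] [NormedSpace ℂ E] [SMul A E] [CStarModule A E] [CompleteSpace E]
  {X Y : Type*} [TopologicalSpace X] [TopologicalSpace Y]

theorem zero_bcfMul (g : C₀(X, ℂ)) : bcfMul 0 g = 0 := by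
  ext x; exact zero_mul _

theorem one_bcfMul (g : C₀(X, ℂ)) : bcfMul 1 g = g := by
  ext x; exact one_mul _

theorem mul_bcfMul (m n : X →ᵇ ℂ) (g : C₀(X, ℂ)) : bcfMul (m * n) g = bcfMul m (bcfMul n g) := by
  ext x; exact mul_assoc _ _ _

theorem add_bcfMul (m n : X →ᵇ ℂ) (g : C₀(X, ℂ)) :
    bcfMul (m + n) g = bcfMul m g + bcfMul n g := by
  ext x; exact add_mul _ _ _

theorem smul_bcfMul (c : ℂ) (m : X →ᵇ ℂ) (g : C₀(X, ℂ)) : bcfMul (c • m) g = c • bcfMul m g := by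
  ext x; exact mul_assoc _ _ _

theorem star_bcfMul_mul_bcfMul (m n : X →ᵇ ℂ) (g h : C₀(X, ℂ)) :
    star (bcfMul m g) * bcfMul n h = star (bcfMul 1 g) * bcfMul (star m * n) h := by
  ext x
  change star (m x * g x) * (n x * h x) = star (1 * g x) * (star (m x) * n x * h x)
  rw [one_mul, star_mul']
  ring

/-- The linear combination `∑ π(m g) v` indexed by formal combinations of pairs `(g, v)`; these
sums determine the multiplier `π(m)`, which sends `∑ π(g) v` to `∑ π(m g) v`. -/
def mulCombination (π : C₀(X, ℂ) →⋆ₙₐ[ℂ] Adjointable A E) (m : X →ᵇ ℂ) :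
    (C₀(X, ℂ) × E →₀ ℂ) →ₗ[ℂ] E :=
  Finsupp.linearCombination ℂ fun p => (π (bcfMul m p.1)).1 p.2

variable {π : C₀(X, ℂ) →⋆ₙₐ[ℂ] Adjointable A E}

theorem mulCombination_single (m : X →ᵇ ℂ) (g : C₀(X, ℂ)) (v : E) (c : ℂ) :
    mulCombination π m (Finsupp.single (g, v) c) = c • (π (bcfMul m g)).1 v :=
  Finsupp.linearCombination_single ℂ c (g, v)

theorem mulCombination_add (m n : X →ᵇ ℂ) :
    mulCombination π (m + n) = mulCombination π m + mulCombination π n :=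
  Finsupp.lhom_ext fun ⟨g, v⟩ c => by
    rw [LinearMap.add_apply, mulCombination_single, mulCombination_single, mulCombination_single,
      add_bcfMul, map_add, val_add, smul_add]

theorem mulCombination_smul (a : ℂ) (m : X →ᵇ ℂ) :
    mulCombination π (a • m) = a • mulCombination π m :=
  Finsupp.lhom_ext fun ⟨g, v⟩ c => by
    rw [LinearMap.smul_apply, mulCombination_single, mulCombination_single, smul_bcfMul, map_smul,
      val_smul, smul_comm]

theorem denseRange_mulCombination_one (hπ : IsNondegenerate π) :
    DenseRange (mulCombination π 1) := by
  have hrange : Set.range (mulCombination π 1) =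
      (Submodule.span ℂ {w : E | ∃ (g : C₀(X, ℂ)) (v : E), w = (π g).1 v} : Set E) := by
    rw [← LinearMap.coe_range, mulCombination, Finsupp.range_linearCombination]
    congr 2
    ext w
    simp only [Set.mem_range, Prod.exists, Set.mem_ofPred_eq, one_bcfMul, eq_comm]
  rw [DenseRange, hrange]
  exact hπ

theorem inner_mulCombination (m n : X →ᵇ ℂ) (u v : C₀(X, ℂ) × E →₀ ℂ) :
    inner A (mulCombination π m u) (mulCombination π n v) =
      inner A (mulCombination π 1 u) (mulCombination π (star m * n) v) := by
  induction u using Finsupp.induction_linear with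
  | zero => simp only [map_zero, CStarModule.inner_zero_left]
  | add u u' hu hu' => simp only [map_add, CStarModule.inner_add_left, hu, hu']
  | single p a =>
    induction v using Finsupp.induction_linear with
    | zero => simp only [map_zero, CStarModule.inner_zero_right]
    | add v v' hv hv' => simp only [map_add, CStarModule.inner_add_right, hv, hv']
    | single q b =>
      obtain ⟨g, x⟩ := p
      obtain ⟨h, y⟩ := q
      simp only [mulCombination_single, CStarModule.inner_smul_left_complex,
        CStarModule.inner_smul_right_complex, inner_apply_left, ← val_mul, ← map_star, ← map_mul,
        star_bcfMul_mul_bcfMul m n]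

theorem norm_mulCombination_le (m : X →ᵇ ℂ) (u : C₀(X, ℂ) × E →₀ ℂ) :
    ‖mulCombination π m u‖ ≤ ‖m‖ * ‖mulCombination π 1 u‖ := by
  obtain ⟨c, hc⟩ := exists_star_mul_self_add_star_mul_self_eq m
  have hsum : inner A (mulCombination π c u) (mulCombination π c u) +
      inner A (mulCombination π m u) (mulCombination π m u) =
      inner A ((‖m‖ : ℂ) • mulCombination π 1 u) ((‖m‖ : ℂ) • mulCombination π 1 u) := by
    rw [inner_mulCombination c c, inner_mulCombination m m, ← CStarModule.inner_add_right,
      ← LinearMap.add_apply, ← mulCombination_add, hc, mulCombination_smul, LinearMap.smul_apply,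
      CStarModule.inner_smul_left_complex, CStarModule.inner_smul_right_complex,
      CStarModule.inner_smul_right_complex, smul_smul, Complex.star_def, Complex.conj_ofReal,
      ← Complex.ofReal_mul, sq]
  have hle := norm_le_of_inner_self_le
    (hsum ▸ le_add_of_nonneg_left (CStarModule.inner_self_nonneg (A := A)))
  rwa [norm_smul, Complex.norm_real, norm_norm] at hle

theorem exists_multiplier (hπ : IsNondegenerate π) (m : X →ᵇ ℂ) :
    ∃ y : Adjointable A E, (∀ g v, y.1 ((π g).1 v) = (π (bcfMul m g)).1 v) ∧
      ∀ g v, (star y).1 ((π g).1 v) = (π (bcfMul (star m) g)).1 v := by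
  have hdense := denseRange_mulCombination_one hπ
  have hsingle (n : X →ᵇ ℂ) (g : C₀(X, ℂ)) (v : E) :
      mulCombination π n (Finsupp.single (g, v) 1) = (π (bcfMul n g)).1 v := by
    rw [mulCombination_single, one_smul]
  obtain ⟨y, hy, hy_star⟩ := exists_adjointable_extension (A := A) hdense hdense (norm_nonneg m)
    (norm_mulCombination_le m) (g := mulCombination π (star m)) fun u v => by
      rw [inner_mulCombination, mul_one]
  refine ⟨y, fun g v => ?_, fun g v => ?_⟩
  · simpa only [hsingle, one_bcfMul] using hy (Finsupp.single (g, v) 1)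
  · simpa only [hsingle, one_bcfMul] using hy_star (Finsupp.single (g, v) 1)

theorem multiplierExt_apply (hπ : IsNondegenerate π) (m : X →ᵇ ℂ) (g : C₀(X, ℂ)) (v : E) :
    (multiplierExt π m).1 ((π g).1 v) = (π (bcfMul m g)).1 v := by
  have hex : ∃ y : Adjointable A E, ∀ g v, y.1 ((π g).1 v) = (π (bcfMul m g)).1 v :=
    (exists_multiplier hπ m).imp fun _ hy => hy.1
  rw [multiplierExt, dif_pos hex]
  exact hex.choose_spec g v

theorem ext_of_isNondegenerate (hπ : IsNondegenerate π) {S T : Adjointable A E}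
    (h : ∀ g v, S.1 ((π g).1 v) = T.1 ((π g).1 v)) : S = T := by
  refine Subtype.ext (ContinuousLinearMap.ext_on hπ ?_)
  rintro _ ⟨g, v, rfl⟩
  exact h g v

theorem multiplierExt_eq (hπ : IsNondegenerate π) {m : X →ᵇ ℂ} {S : Adjointable A E}
    (h : ∀ g v, S.1 ((π g).1 v) = (π (bcfMul m g)).1 v) : multiplierExt π m = S :=
  ext_of_isNondegenerate hπ fun g v => by rw [multiplierExt_apply hπ, h]

theorem star_multiplierExt_apply (hπ : IsNondegenerate π) (m : X →ᵇ ℂ) (g : C₀(X, ℂ)) (v : E) :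
    (star (multiplierExt π m)).1 ((π g).1 v) = (π (bcfMul (star m) g)).1 v := by
  obtain ⟨y, hy, hy_star⟩ := exists_multiplier hπ m
  rw [multiplierExt_eq hπ hy, hy_star]

/-- The extension of a non-degenerate ⋆-homomorphism to bounded functions, as a unital
⋆-homomorphism. -/
def multiplierHom (hπ : IsNondegenerate π) : (X →ᵇ ℂ) →⋆ₐ[ℂ] Adjointable A E where
  toFun := multiplierExt π
  map_one' := multiplierExt_eq hπ fun g v => by rw [one_bcfMul, val_one]
  map_mul' m n := multiplierExt_eq hπ fun g v => by
    rw [val_mul, multiplierExt_apply hπ, multiplierExt_apply hπ, mul_bcfMul]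
  map_zero' := multiplierExt_eq hπ fun g v => by
    rw [zero_bcfMul, map_zero]; rfl
  map_add' m n := multiplierExt_eq hπ fun g v => by
    rw [val_add, multiplierExt_apply hπ, multiplierExt_apply hπ, add_bcfMul, map_add, val_add]
  commutes' c := multiplierExt_eq hπ fun g v => by
    rw [Algebra.algebraMap_eq_smul_one, Algebra.algebraMap_eq_smul_one, smul_bcfMul, one_bcfMul,
      map_smul, val_smul, val_smul, val_one]
  map_star' m := multiplierExt_eq hπ (star_multiplierExt_apply hπ m)

theorem multiplierHom_apply (hπ : IsNondegenerate π) (m : X →ᵇ ℂ) :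
    multiplierHom hπ m = multiplierExt π m := rfl

theorem multiplierExt_toBCF (hπ : IsNondegenerate π) (g : C₀(X, ℂ)) :
    multiplierExt π g.toBCF = π g :=
  multiplierExt_eq hπ fun h v =>
    congrArg (fun S : Adjointable A E => S.1 v) (map_mul π g h).symm

/-- The comparison only has to be made on `C₀(Y)`, since both sides are multipliers of `π`. -/
theorem multiplierExt_eq_multiplierExt_compContinuous (hπ : IsNondegenerate π)
    {ρ : C₀(Y, ℂ) →⋆ₙₐ[ℂ] Adjointable A E} (hρ : IsNondegenerate ρ) (ι : C(X, Y))
    (h : ∀ g : C₀(Y, ℂ), multiplierExt π (g.toBCF.compContinuous ι) = ρ g) (m : Y →ᵇ ℂ) :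
    multiplierExt ρ m = multiplierExt π (m.compContinuous ι) :=
  multiplierExt_eq hρ fun g v => by
    have hmul : (bcfMul m g).toBCF.compContinuous ι =
        m.compContinuous ι * g.toBCF.compContinuous ι := rfl
    rw [← h, ← h, hmul, ← multiplierHom_apply hπ, ← multiplierHom_apply hπ,
      ← multiplierHom_apply hπ, map_mul, val_mul]

theorem affiliatedImage_eq_affiliatedImage_comp (hπ : IsNondegenerate π)
    {ρ : C₀(Y, ℂ) →⋆ₙₐ[ℂ] Adjointable A E} (hρ : IsNondegenerate ρ) (ι : C(X, Y))
    (h : ∀ g : C₀(Y, ℂ), multiplierExt π (g.toBCF.compContinuous ι) = ρ g) (f : C(Y, ℂ)) :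
    affiliatedImage ρ f = affiliatedImage π (f.comp ι) :=
  congrArg ofZTransform (multiplierExt_eq_multiplierExt_compContinuous hπ hρ ι h (zFun f))

/-- The witness is `c = b̄ / max(|b|², η)`, where `η` is a lower bound of `|b|²` on `K`. -/
theorem exists_mul_eq_one_on_isCompact {b : X →ᵇ ℂ} (hb : ∀ x, b x ≠ 0) {K : Set X}
    (hK : IsCompact K) :
    ∃ c : X →ᵇ ℂ, (∀ x ∈ K, b x * c x = 1) ∧ ∀ x, ‖1 - b x * c x‖ ≤ 1 := by
  obtain ⟨η, hη, hηK⟩ : ∃ η : ℝ, 0 < η ∧ ∀ x ∈ K, η ≤ ‖b x‖ ^ 2 :=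
    hK.exists_forall_le' (by fun_prop) fun x _ => pow_pos (norm_pos_iff.mpr (hb x)) 2
  have hpos (x : X) : 0 < max (‖b x‖ ^ 2) η := lt_max_of_lt_right hη
  let c : X →ᵇ ℂ := .ofNormedAddCommGroup (fun x => star (b x) / ((max (‖b x‖ ^ 2) η : ℝ) : ℂ))
    (.div (by fun_prop) (by fun_prop) fun x => Complex.ofReal_ne_zero.mpr (hpos x).ne') (‖b‖ / η)
    fun x => by
      rw [norm_div, norm_star, Complex.norm_real, Real.norm_of_nonneg (hpos x).le]
      exact div_le_div₀ (norm_nonneg b) (b.norm_coe_le_norm x) hη (le_max_right _ _)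
  have hbc (x : X) : b x * c x = ((‖b x‖ ^ 2 / max (‖b x‖ ^ 2) η : ℝ) : ℂ) := by
    change b x * (star (b x) / _) = _
    rw [← mul_div_assoc, Complex.star_def, Complex.mul_conj, Complex.normSq_eq_norm_sq,
      Complex.ofReal_div]
  refine ⟨c, fun x hx => ?_, fun x => ?_⟩
  · rw [hbc, max_eq_left (hηK x hx), div_self (pow_ne_zero 2 (norm_ne_zero_iff.mpr (hb x))),
      Complex.ofReal_one]
  · have hle : ‖b x‖ ^ 2 / max (‖b x‖ ^ 2) η ≤ 1 := (div_le_one (hpos x)).mpr (le_max_left _ _)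
    have hnonneg : 0 ≤ ‖b x‖ ^ 2 / max (‖b x‖ ^ 2) η := div_nonneg (sq_nonneg _) (hpos x).le
    rw [hbc, ← Complex.ofReal_one, ← Complex.ofReal_sub, Complex.norm_real,
      Real.norm_of_nonneg (sub_nonneg.mpr hle)]
    exact sub_le_self 1 hnonneg

theorem denseRange_bcfMul {b : X →ᵇ ℂ} (hb : ∀ x, b x ≠ 0) : DenseRange (bcfMul b) := by
  refine Metric.denseRange_iff.mpr fun g ε hε => ?_
  obtain ⟨K, hK, hgK⟩ : ∃ K : Set X, IsCompact K ∧ ∀ x ∉ K, ‖g x‖ < ε / 2 :=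
    Filter.mem_cocompact.mp
      (g.zero_at_infty'.norm.eventually_lt_const (by rw [norm_zero]; positivity))
  obtain ⟨c, hcK, hc⟩ := exists_mul_eq_one_on_isCompact hb hK
  refine ⟨bcfMul c g, ?_⟩
  rw [dist_eq_norm, ← ZeroAtInftyContinuousMap.norm_toBCF_eq_norm]
  refine lt_of_le_of_lt ((BoundedContinuousFunction.norm_le (half_pos hε).le).mpr fun x => ?_)
    (half_lt_self hε)
  have hx : (g - bcfMul b (bcfMul c g)).toBCF x = (1 - b x * c x) * g x := by
    change g x - b x * (c x * g x) = _
    ring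
  rw [hx, norm_mul]
  by_cases hxK : x ∈ K
  · rw [hcK x hxK, sub_self, norm_zero, zero_mul]
    positivity
  · exact (mul_le_of_le_one_left (norm_nonneg _) (hc x)).trans (hgK x hxK).le

theorem denseRange_multiplierExt (hπ : IsNondegenerate π) {b : X →ᵇ ℂ} (hb : ∀ x, b x ≠ 0) :
    DenseRange (multiplierExt π b).1 := by
  let range := LinearMap.range ((multiplierExt π b).1 : E →ₗ[ℂ] E)
  suffices Dense (range.topologicalClosure : Set E) from dense_closure.mp this
  refine hπ.mono (Submodule.span_le.mpr ?_)
  rintro _ ⟨g, v, rfl⟩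
  have hcont : Continuous fun g => (π g).1 v :=
    (ContinuousLinearMap.apply ℂ E v).continuous.comp
      (isometry_val.continuous.comp (map_continuous π))
  refine (denseRange_bcfMul hb).induction_on g (isClosed_closure.preimage hcont) fun h => ?_
  exact subset_closure ⟨(π h).1 v, multiplierExt_apply hπ b h v⟩

end Multiplier

section AdjointGraph

variable {A E : Type*} [NonUnitalCStarAlgebra A] [PartialOrder A]
  [NormedAddCommGroup E] [NormedSpace ℂ E] [SMul A E] [CStarModule A E] {T : E →ₗ.[ℂ] E}

theorem mem_adjointGraph_iff {p : E × E} :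
    p ∈ adjointGraph A T ↔ ∀ x y, (x, y) ∈ T.graph → inner A y p.1 = inner A x p.2 := by
  refine ⟨fun hp x y hxy => ?_, fun hp u => hp u (T u) (T.mem_graph u)⟩
  obtain ⟨u, rfl, rfl⟩ := (LinearPMap.mem_graph_iff T).mp hxy
  exact hp u

theorem mem_domain_adjoint_iff {v : E} :
    v ∈ (adjoint A T).domain ↔ ∃ s, (v, s) ∈ adjointGraph A T := by
  rw [adjoint, Submodule.toLinearPMap_domain, Submodule.mem_map]
  exact ⟨fun ⟨p, hp, h⟩ => ⟨p.2, h ▸ hp⟩, fun ⟨s, hs⟩ => ⟨(v, s), hs, rfl⟩⟩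

theorem denseRange_fst_adjointGraph (hT' : Dense ((adjoint A T).domain : Set E)) :
    DenseRange (LinearMap.fst ℂ E E ∘ₗ (adjointGraph A T).subtype) := by
  refine hT'.mono fun v hv => ?_
  obtain ⟨s, hs⟩ := mem_domain_adjoint_iff.mp hv
  exact ⟨⟨(v, s), hs⟩, rfl⟩

variable [StarOrderedRing A]

theorem isClosed_adjointGraph (T : E →ₗ.[ℂ] E) : IsClosed (adjointGraph A T : Set (E × E)) := by
  have hInter : (adjointGraph A T : Set (E × E)) =
      ⋂ u : T.domain, {p | inner A (T u) p.1 = inner A (u : E) p.2} := by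
    ext p
    simp only [Set.mem_iInter]
    rfl
  rw [hInter]
  exact isClosed_iInter fun u => isClosed_eq ((continuous_inner_right (T u)).comp continuous_fst)
    ((continuous_inner_right (u : E)).comp continuous_snd)

theorem graph_adjoint (hT : Dense (T.domain : Set E)) :
    (adjoint A T).graph = adjointGraph A T := by
  refine Submodule.toLinearPMap_graph_eq _ fun p hp hp₁ => ?_
  refine eq_of_dense_inner (A := A) hT fun x hx => ?_
  rw [← hp ⟨x, hx⟩, hp₁, CStarModule.inner_zero_right, CStarModule.inner_zero_right]

theorem eq_zero_of_mem_graph_of_neg_mem_adjointGraph {x y : E} (hxy : (x, y) ∈ T.graph)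
    (hyx : (y, -x) ∈ adjointGraph A T) : x = 0 ∧ y = 0 := by
  have hsum : inner A x x + inner A y y = 0 := by
    rw [mem_adjointGraph_iff.mp hyx x y hxy, CStarModule.inner_neg_right, add_neg_cancel]
  obtain ⟨hx, hy⟩ := (add_eq_zero_iff_of_nonneg CStarModule.inner_self_nonneg
    CStarModule.inner_self_nonneg).mp hsum
  exact ⟨CStarModule.inner_self.mp hx, CStarModule.inner_self.mp hy⟩

end AdjointGraph

section Resolvent

variable {A E : Type*} [NonUnitalCStarAlgebra A] [PartialOrder A]
  [NormedAddCommGroup E] [NormedSpace ℂ E] [SMul A E] [CStarModule A E] {T : E →ₗ.[ℂ] E}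

/-- `R = (1 + T⋆T)⁻¹` and `B = T (1 + T⋆T)⁻¹`, expressed through graphs: `R w ∈ D(T)`,
`T R w = B w` and `T⋆ B w = w - R w`. -/
structure IsResolventPair (T : E →ₗ.[ℂ] E) (R B : Adjointable A E) : Prop where
  mem_graph : ∀ w, (R.1 w, B.1 w) ∈ T.graph
  mem_adjointGraph : ∀ w, (B.1 w, w - R.1 w) ∈ adjointGraph A T

namespace IsResolventPair

variable {R B : Adjointable A E}

theorem inner_eq_add (h : IsResolventPair T R B) {x y : E} (hxy : (x, y) ∈ T.graph) (w : E) :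
    inner A w x = inner A (R.1 w) x + inner A (B.1 w) y := by
  have hBw := congrArg star (mem_adjointGraph_iff.mp (h.mem_adjointGraph w) x y hxy)
  rw [CStarModule.star_inner, CStarModule.star_inner, CStarModule.inner_sub_left] at hBw
  rw [hBw, add_sub_cancel]

variable [StarOrderedRing A]

theorem unique (h : IsResolventPair T R B) {R' B' : Adjointable A E}
    (h' : IsResolventPair T R' B') : R = R' ∧ B = B' := by
  have hdiff (w : E) : R.1 w - R'.1 w = 0 ∧ B.1 w - B'.1 w = 0 := by
    have hadj := (adjointGraph A T).sub_mem (h.mem_adjointGraph w) (h'.mem_adjointGraph w)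
    rw [Prod.mk_sub_mk, sub_sub_sub_cancel_left, ← neg_sub (R.1 w)] at hadj
    exact eq_zero_of_mem_graph_of_neg_mem_adjointGraph
      (T.graph.sub_mem (h.mem_graph w) (h'.mem_graph w)) hadj
  exact ⟨Adjointable.ext fun w => sub_eq_zero.mp (hdiff w).1,
    Adjointable.ext fun w => sub_eq_zero.mp (hdiff w).2⟩

theorem star_mul_self_add (h : IsResolventPair T R B) : star R * R + star B * B = R :=
  adjointable_ext fun w v => by
    rw [h.inner_eq_add (h.mem_graph v), val_add, val_mul, val_mul, CStarModule.inner_add_right,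
      inner_apply_left, inner_apply_left]

theorem star_left (h : IsResolventPair T R B) : star R = R := by
  rw [← h.star_mul_self_add, star_add, star_mul, star_mul, star_star, star_star]

theorem apply_add_star_apply (h : IsResolventPair T R B) {x y : E} (hxy : (x, y) ∈ T.graph) :
    R.1 x + (star B).1 y = x :=
  eq_of_forall_inner (A := A) fun w => by
    rw [h.inner_eq_add hxy, CStarModule.inner_add_right, inner_apply_left, inner_apply_left,
      h.star_left]

theorem star_apply_eq (h : IsResolventPair T R B) {v s : E} (hvs : (v, s) ∈ adjointGraph A T) :
    (star B).1 v = R.1 s :=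
  eq_of_forall_inner (A := A) fun w => by
    rw [← inner_apply_left, mem_adjointGraph_iff.mp hvs _ _ (h.mem_graph w), inner_apply_left,
      h.star_left]

theorem dense_range (h : IsResolventPair T R B) (hT : Dense (T.domain : Set E)) :
    Dense {y : E | ∃ (x : T.domain) (h : T x ∈ (adjoint A T).domain),
      y = (x : E) + adjoint A T ⟨T x, h⟩} := by
  refine dense_univ.mono fun w _ => ?_
  have hx := LinearPMap.mem_domain_of_mem_graph (h.mem_graph w)
  have hB : B.1 w = T ⟨R.1 w, hx⟩ := (LinearPMap.image_iff hx).mpr (h.mem_graph w)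
  have hadj := h.mem_adjointGraph w
  rw [← graph_adjoint hT, hB] at hadj
  have hTx := LinearPMap.mem_domain_of_mem_graph hadj
  refine ⟨⟨R.1 w, hx⟩, hTx, ?_⟩
  rw [← (LinearPMap.image_iff hTx).mpr hadj, add_sub_cancel]

theorem denseRange (h : IsResolventPair T R B) (hT : Dense (T.domain : Set E))
    (hT' : Dense ((adjoint A T).domain : Set E)) : DenseRange R.1 := by
  let range := LinearMap.range (R.1 : E →ₗ[ℂ] E)
  have hB (y : E) : (star B).1 y ∈ range.topologicalClosure := by
    have hclosed : IsClosed {y | (star B).1 y ∈ range.topologicalClosure} :=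
      isClosed_closure.preimage (star B).1.continuous
    refine hclosed.closure_subset_iff.mpr (fun v hv => ?_) (hT' y)
    obtain ⟨s, hs⟩ := mem_domain_adjoint_iff.mp hv
    exact subset_closure ⟨s, (h.star_apply_eq hs).symm⟩
  suffices Dense (range.topologicalClosure : Set E) from dense_closure.mp this
  intro x
  refine hT.mono (fun x hx => ?_) x
  obtain ⟨y, hxy⟩ := T.mem_domain_iff.mp hx
  have hx_eq := h.apply_add_star_apply hxy
  exact hx_eq ▸ range.topologicalClosure.add_mem (subset_closure ⟨x, rfl⟩) (hB y)

end IsResolventPair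

variable (A) in
/-- The graph of `x ↦ (T x, T⋆T x)`, as a space of triples. -/
def gramGraph (T : E →ₗ.[ℂ] E) : Submodule ℂ (E × E × E) :=
  T.graph.comap ((LinearMap.fst ℂ E (E × E)).prod
    (LinearMap.fst ℂ E E ∘ₗ LinearMap.snd ℂ E (E × E))) ⊓
  (adjointGraph A T).comap (LinearMap.snd ℂ E (E × E))

variable (A) in
/-- The operator `1 + T⋆T`, as the linear map `(x, T x, T⋆T x) ↦ x + T⋆T x`. -/
def oneAddGram (T : E →ₗ.[ℂ] E) : gramGraph A T →ₗ[ℂ] E :=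
  (LinearMap.fst ℂ E (E × E) + LinearMap.snd ℂ E E ∘ₗ LinearMap.snd ℂ E (E × E)) ∘ₗ
    (gramGraph A T).subtype

theorem oneAddGram_apply (n : gramGraph A T) : oneAddGram A T n = n.1.1 + n.1.2.2 := rfl

theorem mem_gramGraph {x y s : E} :
    (x, y, s) ∈ gramGraph A T ↔ (x, y) ∈ T.graph ∧ (y, s) ∈ adjointGraph A T := Iff.rfl

theorem inner_add_of_mem_gramGraph {x y s x' y' s' : E} (h : (x, y, s) ∈ gramGraph A T)
    (h' : (x', y', s') ∈ gramGraph A T) :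
    inner A x (x' + s') = inner A x x' + inner A y y' := by
  obtain ⟨hxy, -⟩ := mem_gramGraph.mp h
  obtain ⟨-, hys'⟩ := mem_gramGraph.mp h'
  rw [CStarModule.inner_add_right, ← mem_adjointGraph_iff.mp hys' x y hxy]

theorem add_inner_of_mem_gramGraph {x y s x' y' s' : E} (h : (x, y, s) ∈ gramGraph A T)
    (h' : (x', y', s') ∈ gramGraph A T) :
    inner A (x + s) x' = inner A x x' + inner A y y' := by
  rw [← CStarModule.star_inner, inner_add_of_mem_gramGraph h' h, star_add,
    CStarModule.star_inner, CStarModule.star_inner]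

theorem inner_add_self_of_mem_gramGraph {x y s : E} (h : (x, y, s) ∈ gramGraph A T) :
    inner A (x + s) (x + s) = inner A x x + 2 • inner A y y + inner A s s := by
  have hys := mem_adjointGraph_iff.mp (mem_gramGraph.mp h).2 x y (mem_gramGraph.mp h).1
  have hsy := congrArg star hys
  rw [CStarModule.star_inner, CStarModule.star_inner] at hsy
  simp only [CStarModule.inner_add_left, CStarModule.inner_add_right, ← hys, ← hsy]
  abel

variable [StarOrderedRing A]

theorem norm_fst_le_of_mem_gramGraph {x y s : E} (h : (x, y, s) ∈ gramGraph A T) :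
    ‖x‖ ≤ ‖x + s‖ := by
  refine norm_le_of_inner_self_le (A := A) ?_
  rw [inner_add_self_of_mem_gramGraph h, add_assoc]
  exact le_add_of_nonneg_right (add_nonneg (nsmul_nonneg CStarModule.inner_self_nonneg 2)
    CStarModule.inner_self_nonneg)

theorem norm_snd_le_of_mem_gramGraph {x y s : E} (h : (x, y, s) ∈ gramGraph A T) :
    ‖y‖ ≤ ‖x + s‖ := by
  have hnonneg (v : E) : 0 ≤ inner A v v := CStarModule.inner_self_nonneg
  refine norm_le_of_inner_self_le (A := A) ?_
  rw [inner_add_self_of_mem_gramGraph h, two_nsmul]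
  exact le_add_of_le_of_nonneg (le_add_of_nonneg_of_le (hnonneg x)
    (le_add_of_nonneg_right (hnonneg y))) (hnonneg s)

theorem denseRange_oneAddGram (hreg : IsRegular A T) : DenseRange (oneAddGram A T) := by
  refine hreg.dense_range.mono ?_
  rintro w ⟨x, h, rfl⟩
  have hTx := (adjoint A T).mem_graph ⟨T x, h⟩
  rw [graph_adjoint hreg.dense_domain] at hTx
  exact ⟨⟨(x, T x, adjoint A T ⟨T x, h⟩), T.mem_graph x, hTx⟩, rfl⟩

variable [CompleteSpace E]

theorem exists_isResolventPair (hreg : IsRegular A T) :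
    ∃ R B : Adjointable A E, IsResolventPair T R B := by
  have hdense := denseRange_oneAddGram hreg
  obtain ⟨R, hR, -⟩ := exists_adjointable_extension (A := A) hdense hdense zero_le_one
    (f := LinearMap.fst ℂ E (E × E) ∘ₗ (gramGraph A T).subtype)
    (g := LinearMap.fst ℂ E (E × E) ∘ₗ (gramGraph A T).subtype)
    (fun n => (norm_fst_le_of_mem_gramGraph n.2).trans_eq (one_mul _).symm)
    (fun n n' => (inner_add_of_mem_gramGraph n.2 n'.2).trans
      (add_inner_of_mem_gramGraph n.2 n'.2).symm)
  obtain ⟨B, hB, -⟩ := exists_adjointable_extension (A := A) hdense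
    (denseRange_fst_adjointGraph hreg.dense_domain_adjoint) zero_le_one
    (f := LinearMap.fst ℂ E E ∘ₗ LinearMap.snd ℂ E (E × E) ∘ₗ (gramGraph A T).subtype)
    (g := (star R).1 ∘ₗ LinearMap.snd ℂ E E ∘ₗ (adjointGraph A T).subtype)
    (fun n => (norm_snd_le_of_mem_gramGraph n.2).trans_eq (one_mul _).symm)
    (fun n p => (mem_adjointGraph_iff.mp p.2 _ _ n.2.1).trans
      ((congrArg (inner A · p.1.2) (hR n).symm).trans (inner_apply_left R _ _)))
  refine ⟨R, B, fun w => ?_, fun w => ?_⟩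
  · have hclosed : IsClosed {w | (R.1 w, B.1 w) ∈ T.graph} :=
      hreg.isClosed.preimage (R.1.continuous.prodMk B.1.continuous)
    refine hdense.induction_on w hclosed fun n => ?_
    rw [hR, hB]
    exact n.2.1
  · have hclosed : IsClosed {w | (B.1 w, w - R.1 w) ∈ adjointGraph A T} :=
      (isClosed_adjointGraph T).preimage
        (B.1.continuous.prodMk (continuous_id.sub R.1.continuous))
    refine hdense.induction_on w hclosed fun n => ?_
    rw [hR, hB, oneAddGram_apply]
    simp only [LinearMap.comp_apply, Submodule.subtype_apply, LinearMap.fst_apply,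
      LinearMap.snd_apply, add_sub_cancel_left]
    exact n.2.2

end Resolvent

section ZTransform

variable {A E : Type*} [NonUnitalCStarAlgebra A] [PartialOrder A] [StarOrderedRing A]
  [NormedAddCommGroup E] [NormedSpace ℂ E] [SMul A E] [CStarModule A E] [CompleteSpace E]

/-- The square root `(1 - z⋆z)^{1/2}`, whose range is the domain of the operator with
`z`-transform `z`. -/
def zRoot (z : Adjointable A E) : Adjointable A E := cfc Real.sqrt (1 - star z * z)

/-- The operators that are the `z`-transform of a regular operator: contractions `z` for which
`(1 - z⋆z)^{1/2}` has dense range. -/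
structure IsZTransform (z : Adjointable A E) : Prop where
  norm_le_one : ‖z‖ ≤ 1
  denseRange : DenseRange (zRoot z).1

variable {z z' q : Adjointable A E}

theorem zRoot_nonneg (z : Adjointable A E) : 0 ≤ zRoot z :=
  cfc_nonneg fun t _ => Real.sqrt_nonneg t

theorem star_zRoot (z : Adjointable A E) : star (zRoot z) = zRoot z :=
  (zRoot_nonneg z).isSelfAdjoint.star_eq

theorem zRoot_eq_sqrt (h : 0 ≤ 1 - star z * z) : zRoot z = CFC.sqrt (1 - star z * z) := by
  rw [CFC.sqrt_eq_real_sqrt _ h, cfcₙ_eq_cfc]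
  rfl

theorem zRoot_eq (hq : 0 ≤ q) (hqz : q * q = 1 - star z * z) : zRoot z = q := by
  have hnonneg : 0 ≤ 1 - star z * z := by
    rw [← hqz]
    exact hq.isSelfAdjoint.mul_self_nonneg
  rw [zRoot_eq_sqrt hnonneg, CFC.sqrt_unique hqz]

theorem isZTransform_of_mul_self_eq (hq : 0 ≤ q) (hqz : q * q = 1 - star z * z)
    (hdense : DenseRange q.1) : IsZTransform z where
  norm_le_one := by
    have hle : star z * z ≤ 1 := by
      rw [← sub_nonneg, ← hqz]
      exact hq.isSelfAdjoint.mul_self_nonneg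
    have hnorm := (CStarAlgebra.norm_le_one_iff_of_nonneg _).mpr hle
    rw [CStarRing.norm_star_mul_self, ← sq] at hnorm
    exact (sq_le_one_iff₀ (norm_nonneg z)).mp hnorm
  denseRange := by rwa [zRoot_eq hq hqz]

namespace IsZTransform

theorem zRoot_mul_self (hz : IsZTransform z) : zRoot z * zRoot z = 1 - star z * z := by
  have hnorm : ‖star z * z‖ ≤ 1 := by
    rw [CStarRing.norm_star_mul_self]
    exact mul_le_one₀ hz.norm_le_one (norm_nonneg z) hz.norm_le_one
  have hnonneg : 0 ≤ 1 - star z * z :=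
    sub_nonneg.mpr ((CStarAlgebra.norm_le_one_iff_of_nonneg _).mp hnorm)
  rw [zRoot_eq_sqrt hnonneg, CFC.sqrt_mul_sqrt_self _ hnonneg]

theorem zRoot_apply_zRoot_add (hz : IsZTransform z) (v : E) :
    (zRoot z).1 ((zRoot z).1 v) + (star z).1 (z.1 v) = v := by
  rw [← val_mul, ← val_mul, ← val_add, hz.zRoot_mul_self, sub_add_cancel, val_one]

theorem eq_zero (hz : IsZTransform z) {v : E} (hv : (zRoot z).1 v = 0) : v = 0 :=
  eq_zero_of_dense_range hz.denseRange (by rwa [star_zRoot])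

theorem graph_eq (hz : IsZTransform z) : (ofZTransform z).graph =
    LinearMap.range (((zRoot z).1 : E →ₗ[ℂ] E).prod (z.1 : E →ₗ[ℂ] E)) := by
  refine Submodule.toLinearPMap_graph_eq _ ?_
  rintro _ ⟨v, rfl⟩ hv
  rw [hz.eq_zero hv, map_zero, Prod.snd_zero]

theorem mem_graph_iff (hz : IsZTransform z) {x y : E} :
    (x, y) ∈ (ofZTransform z).graph ↔ ∃ v, (zRoot z).1 v = x ∧ z.1 v = y := by
  rw [hz.graph_eq, LinearMap.mem_range]
  exact exists_congr fun v => Prod.ext_iff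

theorem mem_graph (hz : IsZTransform z) (v : E) :
    ((zRoot z).1 v, z.1 v) ∈ (ofZTransform z).graph :=
  hz.mem_graph_iff.mpr ⟨v, rfl, rfl⟩

theorem mem_domain_iff (hz : IsZTransform z) {x : E} :
    x ∈ (ofZTransform z).domain ↔ ∃ v, (zRoot z).1 v = x := by
  simp only [LinearPMap.mem_domain_iff, hz.mem_graph_iff]
  exact ⟨fun ⟨_, v, hv, _⟩ => ⟨v, hv⟩, fun ⟨v, hv⟩ => ⟨_, v, hv, rfl⟩⟩

theorem dense_domain (hz : IsZTransform z) : Dense ((ofZTransform z).domain : Set E) :=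
  hz.denseRange.mono fun _ hx => hz.mem_domain_iff.mpr hx

theorem apply (hz : IsZTransform z) (v : E) (x : (ofZTransform z).domain)
    (hx : (zRoot z).1 v = x) : ofZTransform z x = z.1 v :=
  LinearPMap.mem_graph_snd_inj _ (LinearPMap.mem_graph _ x) (hz.mem_graph v) hx.symm

theorem isClosed (hz : IsZTransform z) : (ofZTransform z).IsClosed := by
  have hgraph : ((ofZTransform z).graph : Set (E × E)) =
      {p | (zRoot z).1 ((zRoot z).1 p.1 + (star z).1 p.2) = p.1} ∩
        {p | z.1 ((zRoot z).1 p.1 + (star z).1 p.2) = p.2} := by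
    ext ⟨x, y⟩
    rw [SetLike.mem_coe, hz.mem_graph_iff]
    refine ⟨?_, fun ⟨hx, hy⟩ => ⟨_, hx, hy⟩⟩
    rintro ⟨v, rfl, rfl⟩
    simp only [Set.mem_inter_iff, Set.mem_ofPred_eq, hz.zRoot_apply_zRoot_add v, and_self]
  rw [LinearPMap.IsClosed, hgraph]
  exact (isClosed_eq (by fun_prop) (by fun_prop)).inter (isClosed_eq (by fun_prop) (by fun_prop))

theorem mem_adjointGraph_iff (hz : IsZTransform z) {p q : E} :
    (p, q) ∈ adjointGraph A (ofZTransform z) ↔ (star z).1 p = (zRoot z).1 q := by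
  rw [HilbertModule.mem_adjointGraph_iff]
  constructor
  · intro h
    refine eq_of_forall_inner (A := A) fun v => ?_
    rw [← inner_apply_left, h _ _ (hz.mem_graph v), inner_apply_left, star_zRoot]
  · intro h x y hxy
    obtain ⟨v, rfl, rfl⟩ := hz.mem_graph_iff.mp hxy
    rw [inner_apply_left, inner_apply_left, star_zRoot, h]

theorem commute_zRoot_star_mul_self (hz : IsZTransform z) : Commute (zRoot z) (star z * z) := by
  rw [← sub_sub_cancel 1 (star z * z), ← hz.zRoot_mul_self]
  exact (Commute.one_right _).sub_right ((Commute.refl _).mul_right (Commute.refl _))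

theorem mem_adjointGraph (hz : IsZTransform z) (w : E) :
    (z.1 ((zRoot z).1 w), (star z).1 (z.1 w)) ∈ adjointGraph A (ofZTransform z) := by
  rw [hz.mem_adjointGraph_iff]
  exact congrArg (·.1 w) hz.commute_zRoot_star_mul_self.eq.symm

theorem isResolventPair (hz : IsZTransform z) :
    IsResolventPair (ofZTransform z) (zRoot z * zRoot z) (z * zRoot z) where
  mem_graph w := hz.mem_graph ((zRoot z).1 w)
  mem_adjointGraph w := by
    rw [hz.zRoot_mul_self, val_sub, val_one, sub_sub_cancel]
    exact hz.mem_adjointGraph w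

end IsZTransform

theorem ofZTransform_injOn : Set.InjOn ofZTransform {z : Adjointable A E | IsZTransform z} := by
  intro z hz z' hz' h
  obtain ⟨hR, hB⟩ := hz.isResolventPair.unique (h ▸ hz'.isResolventPair)
  have hroot : zRoot z = zRoot z' := by
    rw [hz.zRoot_mul_self, hz'.zRoot_mul_self] at hR
    exact congrArg (cfc Real.sqrt) hR
  rw [← hroot] at hB
  refine Adjointable.ext_of_dense hz.denseRange ?_
  rintro _ ⟨v, rfl⟩
  rw [← val_mul, hB, val_mul]

section Normal

theorem zRoot_star (z : Adjointable A E) [IsStarNormal z] : zRoot (star z) = zRoot z := by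
  rw [zRoot, zRoot, star_star, star_comm_self' z]

theorem commute_zRoot (z : Adjointable A E) [IsStarNormal z] : Commute (zRoot z) z :=
  Commute.cfc_real ((Commute.one_left z).sub_left
    ((star_comm_self (x := z)).mul_left (Commute.refl z))) _

theorem commute_zRoot_star (z : Adjointable A E) [IsStarNormal z] :
    Commute (zRoot z) (star z) := by
  rw [← zRoot_star z]
  exact commute_zRoot (star z)

namespace IsZTransform

variable [IsStarNormal z]

protected theorem star (hz : IsZTransform z) : IsZTransform (star z) where
  norm_le_one := by rw [norm_star]; exact hz.norm_le_one
  denseRange := by rw [zRoot_star]; exact hz.denseRange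

theorem adjoint_eq (hz : IsZTransform z) :
    adjoint A (ofZTransform z) = ofZTransform (star z) := by
  refine LinearPMap.eq_of_eq_graph ?_
  rw [graph_adjoint hz.dense_domain]
  ext ⟨p, q⟩
  rw [hz.mem_adjointGraph_iff, hz.star.mem_graph_iff, zRoot_star]
  constructor
  · intro h
    refine ⟨(zRoot z).1 p + z.1 q, ?_, ?_⟩
    · rw [map_add, ← val_mul (zRoot z) z, (commute_zRoot z).eq, val_mul, ← h, ← val_mul z,
        ← star_comm_self' z, val_mul, hz.zRoot_apply_zRoot_add]
    · rw [map_add, ← val_mul (star z), ← (commute_zRoot_star z).eq, val_mul, h,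
        hz.zRoot_apply_zRoot_add]
  · rintro ⟨v, rfl, rfl⟩
    rw [← val_mul, ← val_mul, (commute_zRoot_star z).eq]

theorem isRegular (hz : IsZTransform z) : IsRegular A (ofZTransform z) where
  dense_domain := hz.dense_domain
  smul_mem a x hx := by
    obtain ⟨v, rfl⟩ := hz.mem_domain_iff.mp hx
    exact hz.mem_domain_iff.mpr ⟨a • v, map_smul_adjointable _ _ _⟩
  map_smul a x hx := by
    obtain ⟨v, rfl⟩ := hz.mem_domain_iff.mp hx
    rw [hz.apply v ⟨_, hx⟩ rfl, hz.apply (a • v) _ (map_smul_adjointable _ _ _),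
      map_smul_adjointable]
  isClosed := hz.isClosed
  dense_domain_adjoint := by
    rw [hz.adjoint_eq]
    exact hz.star.dense_domain
  dense_range := hz.isResolventPair.dense_range hz.dense_domain

theorem isNormal (hz : IsZTransform z) : IsNormal A (ofZTransform z) := by
  have hdomain : (ofZTransform z).domain = (adjoint A (ofZTransform z)).domain := by
    ext x
    rw [hz.adjoint_eq, hz.mem_domain_iff, hz.star.mem_domain_iff, zRoot_star]
  refine ⟨hdomain, fun ⟨x, hx⟩ => ?_⟩
  obtain ⟨v, rfl⟩ := hz.mem_domain_iff.mp hx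
  have hgraph : ((zRoot z).1 v, (star z).1 v) ∈ (adjoint A (ofZTransform z)).graph := by
    rw [hz.adjoint_eq, ← zRoot_star]
    exact hz.star.mem_graph v
  have hadj := (LinearPMap.image_iff (hdomain ▸ hx)).mpr hgraph
  rw [hz.apply v _ rfl, ← hadj, inner_apply_left, inner_apply_left, star_star, ← val_mul, ← val_mul,
    star_comm_self' z]

end IsZTransform

end Normal

end ZTransform

section Existence

variable {A E : Type*} [NonUnitalCStarAlgebra A] [PartialOrder A] [StarOrderedRing A]
  [NormedAddCommGroup E] [NormedSpace ℂ E] [SMul A E] [CStarModule A E] {T : E →ₗ.[ℂ] E}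

theorem IsNormal.inner_eq (hnormal : IsNormal A T) (hT : Dense (T.domain : Set E))
    {x y s x' y' s' : E} (hxy : (x, y) ∈ T.graph) (hxs : (x, s) ∈ adjointGraph A T)
    (hxy' : (x', y') ∈ T.graph) (hxs' : (x', s') ∈ adjointGraph A T) :
    inner A y y' = inner A s s' := by
  obtain ⟨hdomain, hinner⟩ := hnormal
  rw [← graph_adjoint hT] at hxs hxs'
  have hx := LinearPMap.mem_domain_of_mem_graph hxy
  have hx' := LinearPMap.mem_domain_of_mem_graph hxy'
  rw [(LinearPMap.image_iff hx).mpr hxy, (LinearPMap.image_iff hx').mpr hxy',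
    (LinearPMap.image_iff (hdomain ▸ hx)).mpr hxs, (LinearPMap.image_iff (hdomain ▸ hx')).mpr hxs']
  exact inner_eq_of_inner_self_eq (f := T.toFun)
    (g := (adjoint A T).toFun ∘ₗ Submodule.inclusion hdomain.le) hinner ⟨x, hx⟩ ⟨x', hx'⟩

variable [CompleteSpace E]

theorem IsResolventPair.nonneg {R B : Adjointable A E} (h : IsResolventPair T R B) : 0 ≤ R := by
  rw [← h.star_mul_self_add]
  exact add_nonneg (star_mul_self_nonneg R) (star_mul_self_nonneg B)

theorem inner_sqrt_apply {R : Adjointable A E} (hR : 0 ≤ R) (v w : E) :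
    inner A ((CFC.sqrt R).1 v) ((CFC.sqrt R).1 w) = inner A (R.1 v) w := by
  rw [inner_apply_right, (CFC.sqrt_nonneg R).isSelfAdjoint.star_eq, ← val_mul,
    CFC.sqrt_mul_sqrt_self R hR]

theorem denseRange_sqrt {R : Adjointable A E} (hR : 0 ≤ R) (hdense : DenseRange R.1) :
    DenseRange (CFC.sqrt R).1 :=
  denseRange_left_of_mul (T := CFC.sqrt R) (by rwa [CFC.sqrt_mul_sqrt_self R hR])

theorem IsResolventPair.exists_mul_sqrt_eq {R B : Adjointable A E} (h : IsResolventPair T R B)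
    (hR : DenseRange R.1) (hT' : Dense ((adjoint A T).domain : Set E)) :
    ∃ z : Adjointable A E, z * CFC.sqrt R = B ∧ star z * z = 1 - R := by
  have hQ := denseRange_sqrt h.nonneg hR
  obtain ⟨z, hz, hz_star⟩ := exists_adjointable_extension (A := A)
    (e := ((CFC.sqrt R).1 : E →ₗ[ℂ] E)) (f := (B.1 : E →ₗ[ℂ] E))
    (g := (CFC.sqrt R).1 ∘ₗ LinearMap.snd ℂ E E ∘ₗ (adjointGraph A T).subtype)
    hQ (denseRange_fst_adjointGraph hT') zero_le_one
    (fun w => by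
      rw [one_mul]
      refine norm_le_of_inner_self_le (A := A) ?_
      change inner A (B.1 w) (B.1 w) ≤ inner A ((CFC.sqrt R).1 w) ((CFC.sqrt R).1 w)
      rw [inner_sqrt_apply h.nonneg, inner_apply_left R, h.star_left,
        h.inner_eq_add (h.mem_graph w)]
      exact le_add_of_nonneg_left CStarModule.inner_self_nonneg)
    (fun w p => (mem_adjointGraph_iff.mp p.2 _ _ (h.mem_graph w)).trans
      (inner_sqrt_apply h.nonneg w p.1.2).symm)
  refine ⟨z, Adjointable.ext hz, Adjointable.ext_of_dense hQ ?_⟩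
  rintro _ ⟨w, rfl⟩
  have hcomm : (CFC.sqrt R).1 (R.1 w) = R.1 ((CFC.sqrt R).1 w) := by
    rw [← val_mul, ← val_mul]
    nth_rw 2 3 [← CFC.sqrt_mul_sqrt_self R h.nonneg]
    rw [mul_assoc]
  calc (star z * z).1 ((CFC.sqrt R).1 w) = (star z).1 (B.1 w) := congrArg (star z).1 (hz w)
    _ = (CFC.sqrt R).1 (w - R.1 w) := hz_star ⟨(B.1 w, w - R.1 w), h.mem_adjointGraph w⟩
    _ = (1 - R).1 ((CFC.sqrt R).1 w) := by rw [map_sub, hcomm, val_sub, val_one]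

theorem IsResolventPair.ofZTransform_eq {z : Adjointable A E} (hz : IsZTransform z)
    (h : IsResolventPair T (zRoot z * zRoot z) (z * zRoot z)) (hT : T.IsClosed) :
    ofZTransform z = T := by
  have hgraph (v : E) : ((zRoot z).1 v, z.1 v) ∈ T.graph :=
    hz.denseRange.induction_on v (hT.preimage ((zRoot z).1.continuous.prodMk z.1.continuous))
      h.mem_graph
  refine LinearPMap.eq_of_eq_graph (Submodule.ext fun ⟨x, y⟩ => hz.mem_graph_iff.trans ⟨?_, ?_⟩)
  · rintro ⟨v, rfl, rfl⟩
    exact hgraph v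
  · intro hxy
    have hx : (zRoot z).1 ((zRoot z).1 x + (star z).1 y) = x := by
      have hx := h.apply_add_star_apply hxy
      rwa [star_mul, star_zRoot, val_mul, val_mul, ← map_add] at hx
    exact ⟨_, hx, LinearPMap.mem_graph_snd_inj T (hgraph _) hxy hx⟩

theorem exists_isZTransform (hreg : IsRegular A T) :
    ∃ z : Adjointable A E, IsZTransform z ∧ ofZTransform z = T := by
  obtain ⟨R, B, h⟩ := exists_isResolventPair hreg
  have hR := h.denseRange hreg.dense_domain hreg.dense_domain_adjoint
  obtain ⟨z, rfl, hzR⟩ := h.exists_mul_sqrt_eq hR hreg.dense_domain_adjoint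
  have hsq : CFC.sqrt R * CFC.sqrt R = 1 - star z * z := by
    rw [CFC.sqrt_mul_sqrt_self R h.nonneg, hzR, sub_sub_cancel]
  have hz := isZTransform_of_mul_self_eq (CFC.sqrt_nonneg R) hsq (denseRange_sqrt h.nonneg hR)
  have hroot := zRoot_eq (CFC.sqrt_nonneg R) hsq
  have h' : IsResolventPair T (CFC.sqrt R * CFC.sqrt R) (z * CFC.sqrt R) := by
    rwa [CFC.sqrt_mul_sqrt_self R h.nonneg]
  rw [← hroot] at h'
  exact ⟨z, hz, h'.ofZTransform_eq hz hreg.isClosed⟩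

variable {z : Adjointable A E}

namespace IsZTransform

theorem sub_mem_adjointGraph (hz : IsZTransform z) (w : E) :
    (w - z.1 ((star z).1 w), (zRoot z).1 ((star z).1 w)) ∈ adjointGraph A (ofZTransform z) := by
  rw [hz.mem_adjointGraph_iff, map_sub, sub_eq_iff_eq_add, hz.zRoot_apply_zRoot_add]

theorem mem_graph_of_forall_mem_adjointGraph (hz : IsZTransform z) {x y : E}
    (h : ∀ p q, (p, q) ∈ adjointGraph A (ofZTransform z) → inner A p y = inner A q x) :
    (x, y) ∈ (ofZTransform z).graph := by
  have hx : (zRoot z).1 ((star z).1 y) = (star z).1 (z.1 x) :=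
    eq_of_forall_inner (A := A) fun w => by
      have hw := h _ _ (hz.mem_adjointGraph w)
      rwa [inner_apply_left, inner_apply_left, inner_apply_left, inner_apply_left, star_star,
        star_zRoot] at hw
  have hy : z.1 ((zRoot z).1 x) = y - z.1 ((star z).1 y) :=
    eq_of_forall_inner (A := A) fun w => by
      have hw := h _ _ (hz.sub_mem_adjointGraph w)
      rwa [CStarModule.inner_sub_left, inner_apply_left, inner_apply_left, inner_apply_left,
        inner_apply_left, star_star, star_zRoot, ← CStarModule.inner_sub_right, eq_comm] at hw
  refine hz.mem_graph_iff.mpr ⟨(zRoot z).1 x + (star z).1 y, ?_, ?_⟩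
  · rw [map_add, hx, hz.zRoot_apply_zRoot_add]
  · rw [map_add, hy, sub_add_cancel]

theorem mem_graph_of_mem_adjointGraph (hz : IsZTransform z)
    (hnormal : IsNormal A (ofZTransform z)) {x y s t : E} (hxy : (x, y) ∈ (ofZTransform z).graph)
    (hxt : (x, t) ∈ adjointGraph A (ofZTransform z))
    (hys : (y, s) ∈ adjointGraph A (ofZTransform z)) : (t, s) ∈ (ofZTransform z).graph := by
  refine hz.mem_graph_of_forall_mem_adjointGraph fun p q hpq => ?_
  have hp : p ∈ (ofZTransform z).domain := by
    rw [hnormal.1]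
    exact mem_domain_adjoint_iff.mpr ⟨q, hpq⟩
  obtain ⟨r, hpr⟩ := LinearPMap.mem_domain_iff.mp hp
  rw [← HilbertModule.mem_adjointGraph_iff.mp hys p r hpr]
  exact hnormal.inner_eq hz.dense_domain hpr hpq hxy hxt

theorem isStarNormal (hz : IsZTransform z) (hnormal : IsNormal A (ofZTransform z)) :
    IsStarNormal z := by
  refine ⟨Adjointable.ext fun w => ?_⟩
  let Q := zRoot z
  have hQw := hz.mem_graph (Q.1 w)
  obtain ⟨t, ht⟩ : ∃ t, (Q.1 (Q.1 w), t) ∈ adjointGraph A (ofZTransform z) := by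
    rw [← mem_domain_adjoint_iff, ← hnormal.1]
    exact LinearPMap.mem_domain_of_mem_graph hQw
  have hgraph := sub_mem (hz.mem_graph_of_mem_adjointGraph hnormal hQw ht (hz.mem_adjointGraph w))
    (hz.mem_graph ((star z).1 w))
  have hadj := sub_mem (hz.sub_mem_adjointGraph w) ht
  have hdiff : w - z.1 ((star z).1 w) - Q.1 (Q.1 w) =
      (star z).1 (z.1 w) - z.1 ((star z).1 w) := by
    rw [sub_right_comm, sub_left_inj, sub_eq_iff_eq_add', hz.zRoot_apply_zRoot_add]
  rw [Prod.mk_sub_mk, hdiff, ← neg_sub t] at hadj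
  exact sub_eq_zero.mp (eq_zero_of_mem_graph_of_neg_mem_adjointGraph hgraph hadj).2

end IsZTransform

theorem exists_zTransform (hreg : IsRegular A T) (hnormal : IsNormal A T) :
    ∃ z : Adjointable A E, IsZTransform z ∧ IsStarNormal z ∧ ofZTransform z = T := by
  obtain ⟨z, hz, rfl⟩ := exists_isZTransform hreg
  exact ⟨z, hz, hz.isStarNormal hnormal, rfl⟩

end Existence

section Affiliated

variable {A E : Type*} [NonUnitalCStarAlgebra A] [PartialOrder A] [StarOrderedRing A]
  [NormedAddCommGroup E] [NormedSpace ℂ E] [SMul A E] [CStarModule A E] [CompleteSpace E]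

theorem IsZTransform.ofZTransform_eq_toPMap {z S : Adjointable A E} (hz : IsZTransform z)
    (hS : S * zRoot z = z) (hsurj : Function.Surjective (zRoot z).1) :
    ofZTransform z = LinearMap.toPMap (S.1 : E →ₗ[ℂ] E) ⊤ := by
  refine LinearPMap.ext (Submodule.ext fun x => iff_of_true ?_ trivial) fun x hx _ => ?_
  · exact hz.mem_domain_iff.mpr (hsurj x)
  · obtain ⟨v, rfl⟩ := hsurj x
    calc ofZTransform z ⟨(zRoot z).1 v, hx⟩ = z.1 v := hz.apply v _ rfl
      _ = S.1 ((zRoot z).1 v) := congrArg (·.1 v) hS.symm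

variable {X : Type*} [TopologicalSpace X]

/-- The bounded function `(1 + |f|²)^{-1/2}`, by which `f` is multiplied to obtain its
`z`-transform `zFun f`. -/
def invRootFun (f : C(X, ℂ)) : X →ᵇ ℂ :=
  .ofNormedAddCommGroup (fun x => (((√(1 + ‖f x‖ ^ 2))⁻¹ : ℝ) : ℂ))
    (Complex.continuous_ofReal.comp
      (.inv₀ (by fun_prop) fun x => (Real.sqrt_pos.mpr (by positivity)).ne'))
    1
    fun x => by
      rw [Complex.norm_real, Real.norm_of_nonneg (by positivity)]
      exact inv_le_one_of_one_le₀ (Real.one_le_sqrt.mpr (le_add_of_nonneg_right (sq_nonneg _)))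

theorem invRootFun_apply (f : C(X, ℂ)) (x : X) :
    invRootFun f x = (((√(1 + ‖f x‖ ^ 2))⁻¹ : ℝ) : ℂ) := rfl

theorem invRootFun_ne_zero (f : C(X, ℂ)) (x : X) : invRootFun f x ≠ 0 := by
  rw [invRootFun_apply, Complex.ofReal_ne_zero]
  positivity

theorem zFun_apply (f : C(X, ℂ)) (x : X) : zFun f x = f x * invRootFun f x := by
  rw [invRootFun_apply, Complex.ofReal_inv, ← div_eq_mul_inv]
  rfl

theorem invRootFun_mul_self (f : C(X, ℂ)) :
    invRootFun f * invRootFun f = 1 - star (zFun f) * zFun f := by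
  ext x
  have hstar : star (zFun f x) * zFun f x =
      ((‖f x‖ ^ 2 * ((√(1 + ‖f x‖ ^ 2))⁻¹) ^ 2 : ℝ) : ℂ) := by
    rw [Complex.star_def, Complex.conj_mul', zFun_apply, invRootFun_apply, norm_mul,
      Complex.norm_real, Real.norm_of_nonneg (by positivity), ← mul_pow, Complex.ofReal_pow]
  change invRootFun f x * invRootFun f x = 1 - star (zFun f x) * zFun f x
  rw [hstar, invRootFun_apply, inv_pow, Real.sq_sqrt (by positivity), ← Complex.ofReal_mul,
    ← sq, inv_pow, Real.sq_sqrt (by positivity), ← Complex.ofReal_one, ← Complex.ofReal_sub]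
  congr 1
  field_simp
  ring

variable {π : C₀(X, ℂ) →⋆ₙₐ[ℂ] Adjointable A E}

theorem multiplierExt_invRootFun_nonneg (hπ : IsNondegenerate π) (f : C(X, ℂ)) :
    0 ≤ multiplierExt π (invRootFun f) := by
  obtain ⟨c, hc⟩ := exists_star_mul_self_eq (m := invRootFun f) fun x =>
    Complex.zero_le_real.mpr (by positivity)
  rw [← hc, ← multiplierHom_apply hπ, map_mul, map_star]
  exact star_mul_self_nonneg _

theorem multiplierExt_invRootFun_mul_self (hπ : IsNondegenerate π) (f : C(X, ℂ)) :
    multiplierExt π (invRootFun f) * multiplierExt π (invRootFun f) =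
      1 - star (multiplierExt π (zFun f)) * multiplierExt π (zFun f) := by
  simp only [← multiplierHom_apply hπ]
  rw [← map_mul, invRootFun_mul_self, map_sub, map_one, map_mul, map_star]

theorem zRoot_multiplierExt (hπ : IsNondegenerate π) (f : C(X, ℂ)) :
    zRoot (multiplierExt π (zFun f)) = multiplierExt π (invRootFun f) :=
  zRoot_eq (multiplierExt_invRootFun_nonneg hπ f) (multiplierExt_invRootFun_mul_self hπ f)

theorem isZTransform_multiplierExt (hπ : IsNondegenerate π) (f : C(X, ℂ)) :
    IsZTransform (multiplierExt π (zFun f)) :=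
  isZTransform_of_mul_self_eq (multiplierExt_invRootFun_nonneg hπ f)
    (multiplierExt_invRootFun_mul_self hπ f) (denseRange_multiplierExt hπ (invRootFun_ne_zero f))

theorem isStarNormal_multiplierExt (hπ : IsNondegenerate π) (m : X →ᵇ ℂ) :
    IsStarNormal (multiplierExt π m) :=
  inferInstanceAs (IsStarNormal (multiplierHom hπ m))

theorem isRegular_affiliatedImage (hπ : IsNondegenerate π) (f : C(X, ℂ)) :
    IsRegular A (affiliatedImage π f) :=
  have := isStarNormal_multiplierExt hπ (zFun f)
  (isZTransform_multiplierExt hπ f).isRegular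

theorem isNormal_affiliatedImage (hπ : IsNondegenerate π) (f : C(X, ℂ)) :
    IsNormal A (affiliatedImage π f) :=
  have := isStarNormal_multiplierExt hπ (zFun f)
  (isZTransform_multiplierExt hπ f).isNormal

theorem exists_invRootFun_mul_eq_one (m : X →ᵇ ℂ) :
    ∃ r : X →ᵇ ℂ, invRootFun m.toContinuousMap * r = 1 := by
  refine ⟨.ofNormedAddCommGroup (fun x => ((√(1 + ‖m x‖ ^ 2) : ℝ) : ℂ)) (by fun_prop)
    (√(1 + ‖m‖ ^ 2)) fun x => ?_, BoundedContinuousFunction.ext fun x => ?_⟩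
  · rw [Complex.norm_real, Real.norm_of_nonneg (by positivity)]
    gcongr
    exact m.norm_coe_le_norm x
  · change (((√(1 + ‖m x‖ ^ 2))⁻¹ : ℝ) : ℂ) * ((√(1 + ‖m x‖ ^ 2) : ℝ) : ℂ) = 1
    rw [← Complex.ofReal_mul, inv_mul_cancel₀ (by positivity), Complex.ofReal_one]

theorem affiliatedImage_bcf (hπ : IsNondegenerate π) (m : X →ᵇ ℂ) :
    affiliatedImage π m.toContinuousMap =
      LinearMap.toPMap ((multiplierExt π m).1 : E →ₗ[ℂ] E) ⊤ := by
  refine (isZTransform_multiplierExt hπ m.toContinuousMap).ofZTransform_eq_toPMap ?_ fun v => ?_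
  · rw [zRoot_multiplierExt hπ, ← multiplierHom_apply hπ, ← multiplierHom_apply hπ,
      ← multiplierHom_apply hπ, ← map_mul]
    exact congrArg (multiplierHom hπ) (BoundedContinuousFunction.ext fun x =>
      (zFun_apply m.toContinuousMap x).symm)
  · obtain ⟨r, hr⟩ := exists_invRootFun_mul_eq_one m
    refine ⟨(multiplierExt π r).1 v, ?_⟩
    rw [zRoot_multiplierExt hπ, ← val_mul, ← multiplierHom_apply hπ, ← multiplierHom_apply hπ,
      ← map_mul, hr, map_one, val_one]

theorem affiliatedImage_toContinuousMap (hπ : IsNondegenerate π) (g : C₀(X, ℂ)) :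
    affiliatedImage π g.toContinuousMap = LinearMap.toPMap ((π g).1 : E →ₗ[ℂ] E) ⊤ := by
  rw [← multiplierExt_toBCF hπ g]
  exact affiliatedImage_bcf hπ g.toBCF

end Affiliated

section Disc

/-- The homeomorphism `t ↦ t (1 + |t|²)^{-1/2}` of the plane onto the open unit disc, which on
scalars is the passage from an operator to its `z`-transform. -/
def discMap (t : ℂ) : ℂ := OpenPartialHomeomorph.univUnitBall t

theorem discMap_eq (t : ℂ) : discMap t = t * (((√(1 + ‖t‖ ^ 2))⁻¹ : ℝ) : ℂ) := by
  rw [discMap, OpenPartialHomeomorph.univUnitBall_apply, Complex.real_smul, mul_comm]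

theorem isOpenEmbedding_discMap : Topology.IsOpenEmbedding discMap :=
  OpenPartialHomeomorph.isOpenEmbedding OpenPartialHomeomorph.univUnitBall rfl

theorem norm_discMap_lt_one (t : ℂ) : ‖discMap t‖ < 1 :=
  mem_ball_zero_iff.mp (OpenPartialHomeomorph.univUnitBall.map_source (Set.mem_univ t))

theorem exists_discMap_eq {w : ℂ} (hw : ‖w‖ < 1) : ∃ t, discMap t = w :=
  ⟨OpenPartialHomeomorph.univUnitBall.symm w,
    OpenPartialHomeomorph.univUnitBall.right_inv (mem_ball_zero_iff.mpr hw)⟩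

/-- The function `(1 - |w|²)^{1/2}`, which on scalars is `zRoot`. -/
def discRoot (w : ℂ) : ℂ := ((√(1 - ‖w‖ ^ 2) : ℝ) : ℂ)

@[fun_prop]
theorem continuous_discRoot : Continuous discRoot := by
  unfold discRoot; fun_prop

theorem discRoot_eq_zero {w : ℂ} (hw : ‖w‖ = 1) : discRoot w = 0 := by
  rw [discRoot, hw, one_pow, sub_self, Real.sqrt_zero, Complex.ofReal_zero]

theorem discRoot_discMap (t : ℂ) : discRoot (discMap t) = (((√(1 + ‖t‖ ^ 2))⁻¹ : ℝ) : ℂ) := by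
  have hnorm : ‖discMap t‖ ^ 2 = ‖t‖ ^ 2 * (1 + ‖t‖ ^ 2)⁻¹ := by
    rw [discMap_eq, norm_mul, Complex.norm_real, Real.norm_of_nonneg (by positivity), mul_pow,
      inv_pow, Real.sq_sqrt (by positivity)]
  rw [discRoot, hnorm, ← Real.sqrt_inv]
  congr 2
  field_simp
  ring

theorem sub_mul_discRoot_eq_zero_iff {c w : ℂ} (hw : ‖w‖ ≤ 1) :
    w - c * discRoot w = 0 ↔ w = discMap c := by
  constructor
  · intro h
    rcases hw.eq_or_lt with hw | hw
    · rw [discRoot_eq_zero hw, mul_zero, sub_zero] at h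
      rw [h, norm_zero] at hw
      exact absurd hw zero_ne_one
    · obtain ⟨t, rfl⟩ := exists_discMap_eq hw
      have hne : (((√(1 + ‖t‖ ^ 2))⁻¹ : ℝ) : ℂ) ≠ 0 := Complex.ofReal_ne_zero.mpr (by positivity)
      rw [discRoot_discMap, discMap_eq, sub_eq_zero] at h
      rw [mul_right_cancel₀ hne h]
  · rintro rfl
    rw [discRoot_discMap, discMap_eq, sub_self]

end Disc

section Spectrum

variable {A E : Type*} [NonUnitalCStarAlgebra A] [PartialOrder A] [StarOrderedRing A]
  [NormedAddCommGroup E] [NormedSpace ℂ E] [SMul A E] [CStarModule A E] [CompleteSpace E]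
  {z : Adjointable A E}

theorem zRoot_eq_cfc (z : Adjointable A E) [hn : IsStarNormal z] : zRoot z = cfc discRoot z := by
  have hdefect : 1 - star z * z = cfc (fun w : ℂ => 1 - star w * w) z := by
    rw [cfc_sub (fun _ => 1) (fun w : ℂ => star w * w) z, cfc_const_one ℂ z,
      cfc_mul (fun w : ℂ => star w) (fun w => w) z, cfc_star_id (a := z), cfc_id' ℂ z]
  have hself : IsSelfAdjoint (1 - star z * z) := .sub (.one _) (.star_mul_self z)
  rw [zRoot, cfc_real_eq_complex _ hself, hdefect,
    ← cfc_comp' (fun w : ℂ => ((√w.re : ℝ) : ℂ)) (fun w : ℂ => 1 - star w * w) z]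
  refine cfc_congr fun w _ => ?_
  change ((√(1 - star w * w).re : ℝ) : ℂ) = ((√(1 - ‖w‖ ^ 2) : ℝ) : ℂ)
  rw [Complex.star_def, Complex.conj_mul']
  norm_cast

theorem sub_smul_zRoot_eq_cfc (z : Adjointable A E) [IsStarNormal z] (c : ℂ) :
    z - c • zRoot z = cfc (fun w => w - c * discRoot w) z := by
  rw [cfc_sub (fun w : ℂ => w) (fun w => c * discRoot w) z, cfc_id' ℂ z,
    cfc_const_mul c discRoot z, zRoot_eq_cfc]

namespace IsZTransform

theorem norm_le_one_of_mem_spectrum (hz : IsZTransform z) {w : ℂ} (hw : w ∈ spectrum ℂ z) :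
    ‖w‖ ≤ 1 := by
  calc ‖w‖ ≤ ‖z‖ * ‖(1 : Adjointable A E)‖ :=
        mem_closedBall_zero_iff.mp (spectrum.subset_closedBall_norm_mul z hw)
    _ ≤ 1 := mul_le_one₀ hz.norm_le_one (norm_nonneg _) ContinuousLinearMap.norm_id_le

theorem isUnit_sub_smul_zRoot_iff (hz : IsZTransform z) [hn : IsStarNormal z] {c : ℂ} :
    IsUnit (z - c • zRoot z) ↔ discMap c ∉ spectrum ℂ z := by
  rw [sub_smul_zRoot_eq_cfc, isUnit_cfc_iff (fun w => w - c * discRoot w) z (by fun_prop) hn]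
  constructor
  · exact fun h hc => h _ hc
      ((sub_mul_discRoot_eq_zero_iff (norm_discMap_lt_one c).le).mpr rfl)
  · intro h w hw h0
    rw [(sub_mul_discRoot_eq_zero_iff (hz.norm_le_one_of_mem_spectrum hw)).mp h0] at hw
    exact h hw

theorem subScalar_apply (hz : IsZTransform z) (c : ℂ) (v : E)
    (x : (subScalar (ofZTransform z) c).domain) (hx : (zRoot z).1 v = x) :
    subScalar (ofZTransform z) c x = (z - c • zRoot z).1 v := by
  calc subScalar (ofZTransform z) c x = ofZTransform z x - c • (x : E) := rfl
    _ = (z - c • zRoot z).1 v := by rw [hz.apply v x hx, val_sub, val_smul, hx]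

theorem isUnit_of_isAdjointableInvertible (hz : IsZTransform z) {c : ℂ}
    (h : IsAdjointableInvertible A (subScalar (ofZTransform z) c)) :
    IsUnit (z - c • zRoot z) := by
  obtain ⟨S, hS_left, hS_right⟩ := h
  have hS_mul : S * (z - c • zRoot z) = zRoot z := Adjointable.ext fun v => by
    have hv := hS_left ⟨(zRoot z).1 v, hz.mem_domain_iff.mpr ⟨v, rfl⟩⟩
    rwa [hz.subScalar_apply c v _ rfl] at hv
  have hleft : (zRoot z * S + star z * (1 + c • S)) * (z - c • zRoot z) = 1 := by
    calc (zRoot z * S + star z * (1 + c • S)) * (z - c • zRoot z)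
      _ = zRoot z * (S * (z - c • zRoot z)) +
            star z * (z - c • zRoot z + c • (S * (z - c • zRoot z))) := by
          rw [add_mul, mul_assoc, mul_assoc, add_mul, one_mul, smul_mul_assoc]
      _ = 1 := by rw [hS_mul, sub_add_cancel, hz.zRoot_mul_self, sub_add_cancel]
  refine isUnit_iff_exists.mpr ⟨_, Adjointable.ext fun y => ?_, hleft⟩
  obtain ⟨hy_mem, hy⟩ := hS_right y
  obtain ⟨v, hv⟩ := hz.mem_domain_iff.mp hy_mem
  rw [hz.subScalar_apply c v _ hv] at hy
  rw [val_one, ← hy, ← val_mul, mul_assoc, hleft, mul_one]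

theorem isAdjointableInvertible_of_isUnit (hz : IsZTransform z) {c : ℂ}
    (h : IsUnit (z - c • zRoot z)) :
    IsAdjointableInvertible A (subScalar (ofZTransform z) c) := by
  obtain ⟨V, hV_right, hV_left⟩ := isUnit_iff_exists.mp h
  refine ⟨zRoot z * V, fun ⟨x, hx⟩ => ?_, fun y => ⟨hz.mem_domain_iff.mpr ⟨V.1 y, rfl⟩, ?_⟩⟩
  · obtain ⟨v, rfl⟩ := hz.mem_domain_iff.mp hx
    rw [hz.subScalar_apply c v _ rfl, ← val_mul, mul_assoc, hV_left, mul_one]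
  · rw [hz.subScalar_apply c (V.1 y) _ rfl, ← val_mul, hV_right, val_one]

theorem mem_opSpectrum_iff (hz : IsZTransform z) [IsStarNormal z] {c : ℂ} :
    c ∈ opSpectrum A (ofZTransform z) ↔ discMap c ∈ spectrum ℂ z := by
  rw [← not_iff_not, ← hz.isUnit_sub_smul_zRoot_iff]
  exact not_not.trans ⟨hz.isUnit_of_isAdjointableInvertible, hz.isAdjointableInvertible_of_isUnit⟩

theorem isClosed_opSpectrum (hz : IsZTransform z) [IsStarNormal z] :
    IsClosed (opSpectrum A (ofZTransform z)) := by
  have hpreimage : opSpectrum A (ofZTransform z) = discMap ⁻¹' spectrum ℂ z :=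
    Set.ext fun c => hz.mem_opSpectrum_iff
  rw [hpreimage]
  exact (spectrum.isClosed z).preimage isOpenEmbedding_discMap.continuous

theorem denseRange_of_isInvertible (hz : IsZTransform z) {c : ℂ}
    (h : IsInvertible A (subScalar (ofZTransform z) c)) : DenseRange (z - c • zRoot z).1 := by
  have hdense := h.2.dense_domain
  rw [LinearPMap.inverse_domain] at hdense
  refine hdense.mono ?_
  rintro _ ⟨x, rfl⟩
  obtain ⟨v, hv⟩ := hz.mem_domain_iff.mp x.2
  exact ⟨v, (hz.subScalar_apply c v x hv).symm⟩

end IsZTransform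

end Spectrum

section ExtendByZero

variable {X Y F : Type*} [TopologicalSpace X] [TopologicalSpace Y]
  [TopologicalSpace F] [Zero F] {j : X → Y} {Ω U : Set Y}

theorem continuousOn_extend_zero [T2Space Y] (hj : Topology.IsEmbedding j) (hU : IsOpen U)
    (hjU : Set.range j = Ω ∩ U) (g : C₀(X, F)) : ContinuousOn (Function.extend j g 0) Ω := by
  intro w hw
  by_cases hwj : w ∈ Set.range j
  · have hrange : ContinuousWithinAt (Function.extend j g 0) (Set.range j) w := by
      obtain ⟨x, rfl⟩ := hwj
      rw [ContinuousWithinAt, ← hj.isInducing.map_nhds_eq, Filter.tendsto_map'_iff,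
        Function.extend_comp hj.injective, hj.injective.extend_apply]
      exact g.continuous.tendsto x
    rw [hjU] at hrange hwj
    exact (continuousWithinAt_inter (hU.mem_nhds hwj.2)).mp hrange
  · refine ContinuousAt.continuousWithinAt fun V hV => ?_
    rw [Function.extend_apply' _ _ _ hwj] at hV
    obtain ⟨K, hK, hKV⟩ := Filter.mem_cocompact.mp (g.zero_at_infty' hV)
    have hwK : w ∉ j '' K := fun hwK => hwj (Set.image_subset_range j K hwK)
    rw [Filter.mem_map]
    filter_upwards [(hK.image hj.continuous).isClosed.isOpen_compl.mem_nhds hwK] with w' hw'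
    by_cases hw'j : w' ∈ Set.range j
    · obtain ⟨x, rfl⟩ := hw'j
      rw [Set.mem_preimage, hj.injective.extend_apply]
      exact hKV fun hx => hw' ⟨x, hx, rfl⟩
    · rw [Set.mem_preimage, Function.extend_apply' _ _ _ hw'j]
      exact mem_of_mem_nhds hV

theorem exists_eqOn_extend_zero (hj : Topology.IsEmbedding j) (hΩ : IsCompact Ω)
    (hjΩ : Set.range j ⊆ Ω) {p : Y → F} (hp : Continuous p)
    (hp_zero : ∀ w ∈ Ω \ Set.range j, p w = 0) :
    ∃ g : C₀(X, F), Set.EqOn (Function.extend j g 0) p Ω := by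
  refine ⟨⟨⟨fun x => p (j x), hp.comp hj.continuous⟩, ?_⟩, fun w hw => ?_⟩
  · intro V hV
    obtain ⟨W, hWV, hW, hW_zero⟩ := mem_nhds_iff.mp hV
    have hcompact : IsCompact (Ω ∩ p ⁻¹' Wᶜ) := hΩ.inter_right (hW.isClosed_compl.preimage hp)
    have hsub : Ω ∩ p ⁻¹' Wᶜ ⊆ Set.range j := fun w hw => by
      by_contra hwj
      exact hw.2 (hp_zero w ⟨hw.1, hwj⟩ ▸ hW_zero)
    rw [Filter.mem_map]
    filter_upwards [((hj.isInducing.isCompact_preimage_iff hsub).mpr hcompact).compl_mem_cocompact]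
      with x hx
    by_contra hxV
    exact hx ⟨hjΩ ⟨x, rfl⟩, fun hxW => hxV (hWV hxW)⟩
  · by_cases hwj : w ∈ Set.range j
    · obtain ⟨x, rfl⟩ := hwj
      exact hj.injective.extend_apply _ _ x
    · rw [Function.extend_apply' _ _ _ hwj, hp_zero w ⟨hw, hwj⟩, Pi.zero_apply]

end ExtendByZero

section DiscExtend

variable {G H : Set ℂ}

/-- The embedding `discMap` of the plane into the unit disc, restricted to `G`. -/
def discEmb (G : Set ℂ) (t : G) : ℂ := discMap t

theorem isEmbedding_discEmb (G : Set ℂ) : Topology.IsEmbedding (discEmb G) :=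
  isOpenEmbedding_discMap.isEmbedding.comp Topology.IsEmbedding.subtypeVal

theorem zFun_idFun_apply (t : G) : zFun (idFun G) t = discEmb G t := by
  rw [zFun_apply, discEmb, discMap_eq]
  rfl

/-- A function on `G`, transported to the unit disc and extended by zero. A function of an operator
is thereby written as a function of its `z`-transform. -/
def discExtend (g : G → ℂ) : ℂ → ℂ := Function.extend (discEmb G) g 0

theorem discExtend_discEmb (g : G → ℂ) (t : G) : discExtend g (discEmb G t) = g t :=
  (isEmbedding_discEmb G).injective.extend_apply _ _ _

theorem discExtend_of_notMem (g : G → ℂ) {w : ℂ} (hw : w ∉ Set.range (discEmb G)) :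
    discExtend g w = 0 :=
  Function.extend_apply' _ _ _ hw

theorem discExtend_eq {g : G → ℂ} {p : ℂ → ℂ} (hp : ∀ t, g t = p (discEmb G t))
    (hp_zero : ∀ w ∉ Set.range (discEmb G), p w = 0) : discExtend g = p := by
  ext w
  by_cases hw : w ∈ Set.range (discEmb G)
  · obtain ⟨t, rfl⟩ := hw
    rw [discExtend_discEmb, hp]
  · rw [discExtend_of_notMem _ hw, hp_zero w hw]

/-- The subset of the closed disc that is obtained from `discMap '' H` by adding the unit circle. -/
def discCompact (H : Set ℂ) : Set ℂ := Metric.closedBall 0 1 \ discMap '' Hᶜ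

theorem isCompact_discCompact (hH : IsClosed H) : IsCompact (discCompact H) :=
  (isCompact_closedBall 0 1).diff (isOpenEmbedding_discMap.isOpenMap _ hH.isOpen_compl)

theorem discMap_mem_discCompact {t : ℂ} : discMap t ∈ discCompact H ↔ t ∈ H := by
  rw [discCompact, Set.mem_sdiff, isOpenEmbedding_discMap.injective.mem_set_image,
    Set.notMem_compl_iff, mem_closedBall_zero_iff, and_iff_right (norm_discMap_lt_one t).le]

theorem range_discEmb_subset (h : G ⊆ H) : Set.range (discEmb G) ⊆ discCompact H := by
  rintro _ ⟨t, rfl⟩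
  exact discMap_mem_discCompact.mpr (h t.2)

theorem range_discEmb_eq (G N : Set ℂ) : Set.range (discEmb G) =
    discCompact (G ∪ N) ∩ (Metric.ball 0 1 \ discMap '' (N \ G)) := by
  ext w
  constructor
  · rintro ⟨t, rfl⟩
    refine ⟨range_discEmb_subset Set.subset_union_left ⟨t, rfl⟩,
      mem_ball_zero_iff.mpr (norm_discMap_lt_one t), ?_⟩
    rw [discEmb, isOpenEmbedding_discMap.injective.mem_set_image]
    exact fun ht => ht.2 t.2
  · rintro ⟨hw, hw_ball, hw_N⟩
    obtain ⟨t, rfl⟩ := exists_discMap_eq (mem_ball_zero_iff.mp hw_ball)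
    rw [isOpenEmbedding_discMap.injective.mem_set_image] at hw_N
    have ht : t ∈ G := (discMap_mem_discCompact.mp hw).elim id fun htN => by
      by_contra htG
      exact hw_N ⟨htN, htG⟩
    exact ⟨⟨t, ht⟩, rfl⟩

theorem continuousOn_discExtend (N : Finset ℂ) (g : C₀(G, ℂ)) :
    ContinuousOn (discExtend g) (discCompact (G ∪ N)) :=
  continuousOn_extend_zero (isEmbedding_discEmb G)
    (Metric.isOpen_ball.sdiff ((N.finite_toSet.sdiff).image discMap).isClosed)
    (range_discEmb_eq G N) g

theorem discRoot_mul_prod_eq_zero (N : Finset ℂ) {w : ℂ}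
    (hw : w ∈ discCompact (G ∪ N) \ Set.range (discEmb G)) :
    discRoot w * ∏ c ∈ N, (w - c * discRoot w) = 0 := by
  have hle : ‖w‖ ≤ 1 := mem_closedBall_zero_iff.mp hw.1.1
  rcases hle.eq_or_lt with hw_one | hw_lt
  · rw [discRoot_eq_zero hw_one, zero_mul]
  · obtain ⟨t, rfl⟩ := exists_discMap_eq hw_lt
    have htN : t ∈ N := (discMap_mem_discCompact.mp hw.1).resolve_left fun ht =>
      hw.2 ⟨⟨t, ht⟩, rfl⟩
    rw [Finset.prod_eq_zero htN ((sub_mul_discRoot_eq_zero_iff hle).mpr rfl), mul_zero]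

end DiscExtend

section CalculusOnSet

variable {A E : Type*} [NonUnitalCStarAlgebra A] [PartialOrder A] [StarOrderedRing A]
  [NormedAddCommGroup E] [NormedSpace ℂ E] [SMul A E] [CStarModule A E] [CompleteSpace E]
  {z : Adjointable A E} [IsStarNormal z] {G H : Set ℂ}

theorem IsZTransform.spectrum_subset_discCompact (hz : IsZTransform z)
    (hH : opSpectrum A (ofZTransform z) ⊆ H) : spectrum ℂ z ⊆ discCompact H := by
  refine fun w hw => ⟨mem_closedBall_zero_iff.mpr (hz.norm_le_one_of_mem_spectrum hw), ?_⟩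
  rintro ⟨t, ht, rfl⟩
  exact ht (hH (hz.mem_opSpectrum_iff.mpr hw))

theorem exists_finset_of_isCompatibleSet (hz : IsZTransform z)
    (hG : IsCompatibleSet A (ofZTransform z) G) :
    ∃ N : Finset ℂ, IsClosed (G ∪ N) ∧ opSpectrum A (ofZTransform z) ⊆ G ∪ N ∧
      ∀ c ∈ N, DenseRange (z - c • zRoot z).1 := by
  classical
  obtain ⟨⟨L, hL⟩, K, hK, hKG⟩ := hG
  have hunion : G ∪ ((L ∪ K).filter (· ∉ G) : Finset ℂ) = G ∪ L ∪ K := by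
    ext c
    simp only [Set.mem_union, Finset.coe_filter, Set.mem_ofPred_eq, Finset.mem_union,
      Finset.mem_coe]
    tauto
  have hspectrum : opSpectrum A (ofZTransform z) ⊆ G ∪ K := by
    rwa [Set.union_comm, ← Set.sdiff_subset_iff]
  refine ⟨(L ∪ K).filter (· ∉ G), ?_, ?_, fun c hc => ?_⟩
  · rw [hunion]
    exact hL.union K.finite_toSet.isClosed
  · rw [hunion]
    exact hspectrum.trans (Set.union_subset_union_left _ Set.subset_union_left)
  · have hcG : c ∉ G := (Finset.mem_filter.mp hc).2
    by_cases hc_spectrum : c ∈ opSpectrum A (ofZTransform z)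
    · exact hz.denseRange_of_isInvertible (hK c ((hspectrum hc_spectrum).resolve_left hcG))
    · rw [hz.mem_opSpectrum_iff, ← hz.isUnit_sub_smul_zRoot_iff] at hc_spectrum
      exact denseRange_of_isUnit hc_spectrum

theorem continuousOn_discExtend_spectrum (hz : IsZTransform z)
    (hG : IsCompatibleSet A (ofZTransform z) G) (g : C₀(G, ℂ)) :
    ContinuousOn (discExtend g) (spectrum ℂ z) := by
  obtain ⟨N, -, hspectrum, -⟩ := exists_finset_of_isCompatibleSet hz hG
  exact (continuousOn_discExtend N g).mono (hz.spectrum_subset_discCompact hspectrum)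

/-- The functional calculus on a compatible set `G` of the operator with `z`-transform `z`: the
continuous functional calculus of `z`, applied to functions on the unit disc. -/
def calculusHom (hz : IsZTransform z) (hG : IsCompatibleSet A (ofZTransform z) G) :
    C₀(G, ℂ) →⋆ₙₐ[ℂ] Adjointable A E where
  toFun g := cfc (discExtend g) z
  map_smul' c g := by
    rw [MonoidHom.id_apply, ← cfc_const_mul c _ z (continuousOn_discExtend_spectrum hz hG g)]
    congr 1
    exact discExtend_eq (fun t => by rw [discExtend_discEmb]; rfl)
      fun w hw => by rw [discExtend_of_notMem _ hw, mul_zero]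
  map_zero' := by
    rw [← cfc_const_zero ℂ z]
    congr 1
    exact discExtend_eq (fun _ => rfl) fun _ _ => rfl
  map_add' g h := by
    rw [← cfc_add z _ _ (continuousOn_discExtend_spectrum hz hG g)
      (continuousOn_discExtend_spectrum hz hG h)]
    congr 1
    exact discExtend_eq (fun t => by rw [discExtend_discEmb, discExtend_discEmb]; rfl)
      fun w hw => by rw [discExtend_of_notMem _ hw, discExtend_of_notMem _ hw, add_zero]
  map_mul' g h := by
    rw [← cfc_mul _ _ z (continuousOn_discExtend_spectrum hz hG g)
      (continuousOn_discExtend_spectrum hz hG h)]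
    congr 1
    exact discExtend_eq (fun t => by rw [discExtend_discEmb, discExtend_discEmb]; rfl)
      fun w hw => by rw [discExtend_of_notMem _ hw, zero_mul]
  map_star' g := by
    rw [← cfc_star]
    congr 1
    exact discExtend_eq (fun t => by rw [discExtend_discEmb]; rfl)
      fun w hw => by rw [discExtend_of_notMem _ hw, star_zero]

theorem calculusHom_apply (hz : IsZTransform z) (hG : IsCompatibleSet A (ofZTransform z) G)
    (g : C₀(G, ℂ)) : calculusHom hz hG g = cfc (discExtend g) z := rfl

theorem denseRange_cfc_discRoot_mul_prod (hz : IsZTransform z) {N : Finset ℂ}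
    (hN : ∀ c ∈ N, DenseRange (z - c • zRoot z).1) :
    DenseRange (cfc (fun w => discRoot w * ∏ c ∈ N, (w - c * discRoot w)) z).1 := by
  classical
  induction N using Finset.induction_on with
  | empty =>
    simp only [Finset.prod_empty, mul_one]
    rw [← zRoot_eq_cfc]
    exact hz.denseRange
  | insert a N ha ih =>
    have hfactor : cfc (fun w => discRoot w * ∏ c ∈ insert a N, (w - c * discRoot w)) z =
        (z - a • zRoot z) * cfc (fun w => discRoot w * ∏ c ∈ N, (w - c * discRoot w)) z := by
      rw [sub_smul_zRoot_eq_cfc, ← cfc_mul (fun w => w - a * discRoot w) _ z]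
      refine cfc_congr fun w _ => ?_
      rw [Finset.prod_insert ha, mul_left_comm]
    rw [hfactor]
    exact denseRange_mul (hN a (Finset.mem_insert_self a N))
      (ih fun c hc => hN c (Finset.mem_insert_of_mem hc))

theorem isNondegenerate_calculusHom (hz : IsZTransform z)
    (hG : IsCompatibleSet A (ofZTransform z) G) : IsNondegenerate (calculusHom hz hG) := by
  obtain ⟨N, hclosed, hspectrum, hdense⟩ := exists_finset_of_isCompatibleSet hz hG
  obtain ⟨g, hg⟩ := exists_eqOn_extend_zero (isEmbedding_discEmb G)
    (isCompact_discCompact hclosed) (range_discEmb_subset Set.subset_union_left)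
    (p := fun w => discRoot w * ∏ c ∈ N, (w - c * discRoot w)) (by fun_prop)
    fun w hw => discRoot_mul_prod_eq_zero N hw
  have hgz : calculusHom hz hG g =
      cfc (fun w => discRoot w * ∏ c ∈ N, (w - c * discRoot w)) z :=
    cfc_congr (hg.mono (hz.spectrum_subset_discCompact hspectrum))
  refine (hgz ▸ denseRange_cfc_discRoot_mul_prod hz hdense).mono ?_
  rintro _ ⟨v, rfl⟩
  exact Submodule.subset_span ⟨g, v, rfl⟩

theorem multiplierExt_calculusHom_zFun_idFun (hz : IsZTransform z)
    (hG : IsCompatibleSet A (ofZTransform z) G) :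
    multiplierExt (calculusHom hz hG) (zFun (idFun G)) = z := by
  refine multiplierExt_eq (isNondegenerate_calculusHom hz hG) fun g v => ?_
  have hfun : discExtend (bcfMul (zFun (idFun G)) g) = fun w => w * discExtend g w :=
    discExtend_eq (fun t => by rw [discExtend_discEmb, ← zFun_idFun_apply]; rfl)
      fun w hw => by rw [discExtend_of_notMem _ hw, mul_zero]
  rw [← val_mul, calculusHom_apply, calculusHom_apply, hfun,
    cfc_mul (fun w => w) _ z (by fun_prop) (continuousOn_discExtend_spectrum hz hG g),
    cfc_id' ℂ z]

theorem isCalculus_calculusHom (hz : IsZTransform z)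
    (hG : IsCompatibleSet A (ofZTransform z) G) :
    IsCalculus (ofZTransform z) (calculusHom hz hG) :=
  ⟨isNondegenerate_calculusHom hz hG,
    congrArg ofZTransform (multiplierExt_calculusHom_zFun_idFun hz hG)⟩

theorem eq_calculusHom (hz : IsZTransform z) (hG : IsCompatibleSet A (ofZTransform z) G)
    {π : C₀(G, ℂ) →⋆ₙₐ[ℂ] Adjointable A E} (hπ : IsCalculus (ofZTransform z) π) :
    π = calculusHom hz hG := by
  obtain ⟨hπ, himage⟩ := hπ
  obtain ⟨N, hclosed, -, -⟩ := exists_finset_of_isCompatibleSet hz hG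
  have hπz : multiplierHom hπ (zFun (idFun G)) = z :=
    ofZTransform_injOn (isZTransform_multiplierExt hπ _) hz himage
  have hspectrum : spectrum ℂ (zFun (idFun G)) ⊆ discCompact (G ∪ N) := by
    refine (spectrum_bcf_subset _).trans
      (closure_minimal ?_ (isCompact_discCompact hclosed).isClosed)
    rw [show ⇑(zFun (idFun G)) = discEmb G from funext zFun_idFun_apply]
    exact range_discEmb_subset Set.subset_union_left
  ext1 g
  have hcont := (continuousOn_discExtend N g).mono hspectrum
  have hg : g.toBCF = cfc (discExtend g) (zFun (idFun G)) := by
    ext t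
    rw [bcf_cfc_apply _ hcont, zFun_idFun_apply, discExtend_discEmb]
    rfl
  calc π g = multiplierHom hπ (cfc (discExtend g) (zFun (idFun G))) := by
        rw [← hg, multiplierHom_apply, multiplierExt_toBCF hπ]
    _ = cfc (discExtend g) (multiplierHom hπ (zFun (idFun G))) :=
        StarAlgHomClass.map_cfc _ _ _ hcont (map_continuous _) inferInstance inferInstance
    _ = calculusHom hz hG g := by rw [hπz, calculusHom_apply]

theorem injective_calculusHom (hz : IsZTransform z) (hG : IsCompatibleSet A (ofZTransform z) G)
    (hsub : G ⊆ opSpectrum A (ofZTransform z)) : Function.Injective (calculusHom hz hG) := by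
  refine (injective_iff_map_eq_zero _).mpr fun g hg => ZeroAtInftyContinuousMap.ext fun t => ?_
  have hmem : g t ∈ spectrum ℂ (calculusHom hz hG g) := by
    rw [calculusHom_apply, cfc_map_spectrum (p := IsStarNormal) _ z inferInstance
      (continuousOn_discExtend_spectrum hz hG g)]
    exact ⟨discEmb G t, hz.mem_opSpectrum_iff.mp (hsub t.2), discExtend_discEmb g t⟩
  rw [hg] at hmem
  by_contra hne
  refine hmem ?_
  rw [spectrum.mem_resolventSet_iff, sub_zero]
  exact (isUnit_iff_ne_zero.mpr hne).map _

theorem multiplierExt_calculusHom_compContinuous (hz : IsZTransform z)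
    (hG : IsCompatibleSet A (ofZTransform z) G) (hH : IsCompatibleSet A (ofZTransform z) H)
    (hsub : G ⊆ H) (g : C₀(H, ℂ)) :
    multiplierExt (calculusHom hz hG)
      (g.toBCF.compContinuous ⟨Set.inclusion hsub, continuous_inclusion hsub⟩) =
        calculusHom hz hH g := by
  refine multiplierExt_eq (isNondegenerate_calculusHom hz hG) fun h v => ?_
  have hfun : discExtend (bcfMul
      (g.toBCF.compContinuous ⟨Set.inclusion hsub, continuous_inclusion hsub⟩) h) =
        fun w => discExtend g w * discExtend h w := by
    refine discExtend_eq (fun t => ?_) fun w hw => by rw [discExtend_of_notMem h hw, mul_zero]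
    rw [discExtend_discEmb]
    exact congrArg (· * h t) (discExtend_discEmb g (Set.inclusion hsub t)).symm
  rw [← val_mul, calculusHom_apply, calculusHom_apply, calculusHom_apply, hfun,
    cfc_mul _ _ z (continuousOn_discExtend_spectrum hz hH g)
      (continuousOn_discExtend_spectrum hz hG h)]

theorem affiliatedImage_calculusHom_restrictTo (hz : IsZTransform z)
    (hG : IsCompatibleSet A (ofZTransform z) G) (hH : IsCompatibleSet A (ofZTransform z) H)
    (hsub : G ⊆ H) (f : C(H, ℂ)) :
    affiliatedImage (calculusHom hz hG) (restrictTo hsub f) =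
      affiliatedImage (calculusHom hz hH) f :=
  (affiliatedImage_eq_affiliatedImage_comp (isNondegenerate_calculusHom hz hG)
    (isNondegenerate_calculusHom hz hH) _
    (multiplierExt_calculusHom_compContinuous hz hG hH hsub) f).symm

end CalculusOnSet

section ExtendedCalculus

variable {A E : Type*} [NonUnitalCStarAlgebra A] [PartialOrder A] [StarOrderedRing A]
  [NormedAddCommGroup E] [NormedSpace ℂ E] [SMul A E] [CStarModule A E] [CompleteSpace E]
  {z : Adjointable A E} [IsStarNormal z] {D G : Set ℂ} {K : Finset ℂ}

theorem isCompatibleSet_opSpectrum_sdiff (hz : IsZTransform z)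
    (hK : ∀ c ∈ K, IsInvertible A (subScalar (ofZTransform z) c)) :
    IsCompatibleSet A (ofZTransform z) (opSpectrum A (ofZTransform z) \ K) := by
  refine ⟨⟨K, ?_⟩, K, hK, subset_rfl⟩
  rw [Set.sdiff_union_self]
  exact hz.isClosed_opSpectrum.union K.finite_toSet.isClosed

theorem isCompatibleSet_opSpectrum (hz : IsZTransform z) :
    IsCompatibleSet A (ofZTransform z) (opSpectrum A (ofZTransform z)) := by
  simpa only [Finset.coe_empty, Set.sdiff_empty] using
    isCompatibleSet_opSpectrum_sdiff hz (K := ∅) fun _ hc => absurd hc (Finset.notMem_empty _)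

theorem stdCalculus_eq (hz : IsZTransform z) :
    stdCalculus A (ofZTransform z) = calculusHom hz (isCompatibleSet_opSpectrum hz) := by
  have hex : ∃ ψ : C₀(opSpectrum A (ofZTransform z), ℂ) →⋆ₙₐ[ℂ] Adjointable A E,
      IsCalculus (ofZTransform z) ψ ∧ Function.Injective ψ :=
    ⟨_, isCalculus_calculusHom hz (isCompatibleSet_opSpectrum hz),
      injective_calculusHom hz _ subset_rfl⟩
  rw [stdCalculus, dif_pos hex]
  exact eq_calculusHom hz _ hex.choose_spec.1

theorem affiliatedImage_restrictTo_eq (hz : IsZTransform z) {K' : Finset ℂ}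
    (hK : IsAdmissible A (ofZTransform z) D K) (hK' : IsAdmissible A (ofZTransform z) D K')
    (f : C(D, ℂ)) :
    affiliatedImage (calculusHom hz (isCompatibleSet_opSpectrum_sdiff hz hK.1))
        (restrictTo hK.2 f) =
      affiliatedImage (calculusHom hz (isCompatibleSet_opSpectrum_sdiff hz hK'.1))
        (restrictTo hK'.2 f) := by
  classical
  have hunion := isCompatibleSet_opSpectrum_sdiff hz (K := K ∪ K') fun c hc =>
    (Finset.mem_union.mp hc).elim (hK.1 c) (hK'.1 c)
  rw [← affiliatedImage_calculusHom_restrictTo hz hunion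
      (isCompatibleSet_opSpectrum_sdiff hz hK.1)
      (Set.sdiff_subset_sdiff_right (Finset.coe_subset.mpr Finset.subset_union_left)),
    ← affiliatedImage_calculusHom_restrictTo hz hunion
      (isCompatibleSet_opSpectrum_sdiff hz hK'.1)
      (Set.sdiff_subset_sdiff_right (Finset.coe_subset.mpr Finset.subset_union_right))]
  rfl

theorem extFun_eq (hz : IsZTransform z) (hK : IsAdmissible A (ofZTransform z) D K)
    (f : C(D, ℂ)) : extFun A (ofZTransform z) f =
      affiliatedImage (calculusHom hz (isCompatibleSet_opSpectrum_sdiff hz hK.1))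
        (restrictTo hK.2 f) := by
  have hex : ∃ (K : Finset ℂ) (_ : IsAdmissible A (ofZTransform z) D K)
      (π : C₀((opSpectrum A (ofZTransform z) \ K : Set ℂ), ℂ) →⋆ₙₐ[ℂ] Adjointable A E),
      IsCalculus (ofZTransform z) π :=
    ⟨K, hK, _, isCalculus_calculusHom hz (isCompatibleSet_opSpectrum_sdiff hz hK.1)⟩
  rw [extFun, dif_pos hex,
    eq_calculusHom hz (isCompatibleSet_opSpectrum_sdiff hz hex.choose_spec.choose.1)
      hex.choose_spec.choose_spec.choose_spec]
  exact affiliatedImage_restrictTo_eq hz hex.choose_spec.choose hK f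

theorem isRegular_extFun (hz : IsZTransform z) (hD : IsCompatibleDomain A (ofZTransform z) D)
    (f : C(D, ℂ)) : IsRegular A (extFun A (ofZTransform z) f) := by
  obtain ⟨K, hK⟩ := hD
  rw [extFun_eq hz hK]
  exact isRegular_affiliatedImage (isNondegenerate_calculusHom hz _) _

theorem isNormal_extFun (hz : IsZTransform z) (hD : IsCompatibleDomain A (ofZTransform z) D)
    (f : C(D, ℂ)) : IsNormal A (extFun A (ofZTransform z) f) := by
  obtain ⟨K, hK⟩ := hD
  rw [extFun_eq hz hK]
  exact isNormal_affiliatedImage (isNondegenerate_calculusHom hz _) _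

theorem extFun_eq_affiliatedImage (hz : IsZTransform z)
    (hG : IsCompatibleSet A (ofZTransform z) G) (f : C(G, ℂ)) :
    extFun A (ofZTransform z) f = affiliatedImage (calculusHom hz hG) f := by
  obtain ⟨K, hK⟩ := hG.2
  rw [extFun_eq hz hK]
  exact affiliatedImage_calculusHom_restrictTo hz _ hG hK.2 f

theorem extFun_toContinuousMap (hz : IsZTransform z)
    (hG : IsCompatibleSet A (ofZTransform z) G) (g : C₀(G, ℂ)) :
    extFun A (ofZTransform z) g.toContinuousMap =
      LinearMap.toPMap ((calculusHom hz hG g).1 : E →ₗ[ℂ] E) ⊤ := by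
  rw [extFun_eq_affiliatedImage hz hG,
    affiliatedImage_toContinuousMap (isNondegenerate_calculusHom hz hG)]

end ExtendedCalculus

end HilbertModule

end

open HilbertModule in
theorem mainTheorem2 {A E : Type*} [NonUnitalCStarAlgebra A] [PartialOrder A] [StarOrderedRing A]
    [NormedAddCommGroup E] [NormedSpace ℂ E] [SMul A E] [CStarModule A E] [CompleteSpace E]
    (T : E →ₗ.[ℂ] E) (hreg : IsRegular A T) (hnormal : IsNormal A T) :
    -- the usual functional calculus of `T` exists, is unique and is injective
    ((∃! ψ : C₀(opSpectrum A T, ℂ) →⋆ₙₐ[ℂ] Adjointable A E, IsCalculus T ψ) ∧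
      IsCalculus T (stdCalculus A T) ∧ Function.Injective (stdCalculus A T)) ∧
    -- the functional calculus on `σ(T) \ K`
    (∀ K : Finset ℂ, (∀ c ∈ K, IsInvertible A (subScalar T c)) →
      ∃ π : C₀((opSpectrum A T \ K : Set ℂ), ℂ) →⋆ₙₐ[ℂ] Adjointable A E,
        IsCalculus T π ∧
        (∀ π' : C₀((opSpectrum A T \ K : Set ℂ), ℂ) →⋆ₙₐ[ℂ] Adjointable A E,
          IsCalculus T π' → π' = π) ∧
        ∀ f : C(opSpectrum A T, ℂ),
          stdFun A T f = affiliatedImage π (restrictTo Set.sdiff_subset f)) ∧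
    -- `f(T)` for compatible functions: a normal regular operator, independent of the choice of `K`
    (∀ (D : Set ℂ) (f : C(D, ℂ)), IsCompatibleDomain A T D →
      IsRegular A (extFun A T f) ∧ IsNormal A (extFun A T f) ∧
      ∀ (K : Finset ℂ) (hK : IsAdmissible A T D K)
        (π : C₀((opSpectrum A T \ K : Set ℂ), ℂ) →⋆ₙₐ[ℂ] Adjointable A E),
        IsCalculus T π → extFun A T f = affiliatedImage π (restrictTo hK.2 f)) ∧
    -- the functional calculus on a compatible set
    (∀ G : Set ℂ, IsCompatibleSet A T G →
      ∃ π : C₀(G, ℂ) →⋆ₙₐ[ℂ] Adjointable A E,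
        IsCalculus T π ∧
        (∀ π' : C₀(G, ℂ) →⋆ₙₐ[ℂ] Adjointable A E, IsCalculus T π' → π' = π) ∧
        (∀ g : C₀(G, ℂ), extFun A T g.toContinuousMap =
          LinearMap.toPMap ((π g).1 : E →ₗ[ℂ] E) ⊤) ∧
        ∀ f : C(G, ℂ), extFun A T f = affiliatedImage π f) := by
  obtain ⟨z, hz, hn, rfl⟩ := exists_zTransform hreg hnormal
  have hσ := isCompatibleSet_opSpectrum hz
  refine ⟨⟨⟨_, isCalculus_calculusHom hz hσ, fun ψ hψ => eq_calculusHom hz hσ hψ⟩, ?_⟩,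
    fun K hK => ?_, fun D f hD => ?_, fun G hG => ?_⟩
  · rw [stdCalculus_eq hz]
    exact ⟨isCalculus_calculusHom hz hσ, injective_calculusHom hz hσ subset_rfl⟩
  · have hσK := isCompatibleSet_opSpectrum_sdiff hz hK
    refine ⟨_, isCalculus_calculusHom hz hσK, fun π' hπ' => eq_calculusHom hz hσK hπ', fun f => ?_⟩
    rw [stdFun, stdCalculus_eq hz]
    exact (affiliatedImage_calculusHom_restrictTo hz hσK hσ Set.sdiff_subset f).symm
  · refine ⟨isRegular_extFun hz hD f, isNormal_extFun hz hD f, fun K hK π hπ => ?_⟩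
    rw [eq_calculusHom hz (isCompatibleSet_opSpectrum_sdiff hz hK.1) hπ]
    exact extFun_eq hz hK f
  · exact ⟨_, isCalculus_calculusHom hz hG, fun π' hπ' => eq_calculusHom hz hG hπ',
      extFun_toContinuousMap hz hG, extFun_eq_affiliatedImage hz hG⟩
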